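/- Let $d = 2m$ with $m$ odd and $m \ge 3$. For a field $K$, let $\Gamma^*(d,K)$ denote the least number $s$ of variables such that for all $a_1,\dots,a_s \in K$ the additive form $a_1x_1^d + \dots + a_sx_s^d$ has a nontrivial zero in $K^s$, that is, a zero $(x_1,\dots,x_s) \neq (0,\dots,0)$. If $K$ is one of $\mathbb{Q}_2(\sqrt{2})$, $\mathbb{Q}_2(\sqrt{10})$, $\mathbb{Q}_2(\sqrt{-2})$, $\mathbb{Q}_2(\sqrt{-10})$, then $\Gamma^*(d,K) = \frac{3}{2}d$. If $K$ is one of $\mathbb{Q}_2(\sqrt{-1})$, $\mathbb{Q}_2(\sqrt{-5})$, then $\Gamma^*(d,K) = d+1$. -/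

import Mathlib

/-- Every additive form `a₁x₁^d + ⋯ + aₛxₛ^d` in `s` variables with coefficients in `K`
has a nontrivial zero over `K`. -/
def GuaranteesZero (d s : ℕ) (K : Type*) [Field K] : Prop :=
  ∀ a : Fin s → K, ∃ x : Fin s → K, x ≠ 0 ∧ ∑ i, a i * x i ^ d = 0

/-- `Γ*(d, K) = n`: the minimum number `s` of variables which guarantees that every additive
form of degree `d` in `s` variables over `K` has a nontrivial zero exists and is equal to `n`. -/
def GammaStarEq (d : ℕ) (K : Type*) [Field K] (n : ℕ) : Prop :=
  IsLeast {s : ℕ | GuaranteesZero d s K} n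

/-- The extension `K` of `ℚ_[2]` is `ℚ₂(√D)`: it is generated over `ℚ_[2]` by a square root
of `D`. -/
def IsQ2Sqrt (D : ℤ) (K : Type*) [Field K] [Algebra ℚ_[2] K] : Prop :=
  ∃ r : K, r ^ 2 = (D : K) ∧ IntermediateField.adjoin ℚ_[2] {r} = ⊤

/-! All fields in question are totally ramified quadratic extensions of `ℚ_[2]`. A uniformizer `π =
√D + c` satisfies `π² = A + Bπ`, and only `A` modulo 8 and `B` modulo 4 matter, that is, `π²` modulo
`π⁵`. This leaves three cases: `π² ≡ 2` for the first four fields, `π² ≡ 6 + 2π` for `√-1`, and `π²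
≡ 2 + 2π` for `√-5` (`exists_isModel`).

Units congruent to 1 modulo `π⁵` are `d`-th powers (`IsModel.exists_root`), so a sum of terms that
is smaller by a factor `π⁵` than one of its terms can be corrected to a zero. Modulo `π⁵` the
residue `(1 + π)^d` is `s = (1 + π)²`, with `s² = 1`, so a unit coefficient counts only up to the
pair `{v, s v}`. This gives eight classes.

Upper bounds. Substituting `π^q x` for a variable moves its term through the levels of one residue
class modulo `d`. Suppose that the form is anisotropic, and walk upwards through the levels. The
state is a set of residues attained by sums of terms from lower levels, divided by `π ^ L`. It grows
with the terms of level `L`, must never contain 0, and is then divided by `π`. Few states are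
reachable. The tables list them with a potential that bounds the number of terms admitted along a
walk, and the kernel checks every transition (`verify_two_zero`, `verify_six_two`,
`verify_two_two`). By `exists_labels_of_anisotropic` an anisotropic form gives an infinite walk
whose term counts have period `d`. With `d + 1` terms per period the potential would decrease
forever (`not_goodUnit`). With `3 m` terms and `π² ≡ 2` the potential need not decrease, but the
steps without loss follow a cycle of length four, which conflicts with the period `d ≡ 2` modulo 4
(`not_goodThreeHalves`).

Lower bounds. The form `∑ π ^ j x_j ^ d` with `j < d` has terms of distinct valuations, hence no
nontrivial zero (`IsModel.anisotropic_powers`). For `π² ≡ 2` a form in `3 m - 1` variables built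
from powers of `θ = π² (1 + π)` is anisotropic (`IsModel.anisotropic_theta`). -/

namespace AdditiveForm

/-! ### Sets of residues modulo `π⁵` as 32-bit masks, and the search over states -/

/-- Addition of residues `a + bπ` modulo `π⁵`, coded as `a + 8b` with `a < 8` and `b < 4`. -/
def addCode (j k : ℕ) : ℕ := (j % 8 + k % 8) % 8 + 8 * ((j / 8 + k / 8) % 4)

/-- Multiplication of coded residues `a + bπ` modulo `π⁵`, where `π² = P + Qπ`. -/
def mulCode (P Q j k : ℕ) : ℕ :=
  ((j % 8) * (k % 8) + (j / 8) * (k / 8) * P) % 8 +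
    8 * (((j % 8) * (k / 8) + (j / 8) * (k % 8) + (j / 8) * (k / 8) * Q) % 4)

/-- Evaluate `n` before passing it to `f`. -/
def force {α : Type*} (n : ℕ) (f : ℕ → α) : α :=
  match n with
  | 0 => f 0
  | k + 1 => f (k + 1)

theorem force_eq {α : Type*} (n : ℕ) (f : ℕ → α) : force n f = f n := by
  cases n <;> rfl

/-- The mask of four bytes, each with its lowest `t` bits set. -/
def byteMask (t : ℕ) : ℕ := (2 ^ t - 1) * 16843009

/-- Rotate each byte of a 32-bit mask by `x` bits. -/
def rotLow (x U : ℕ) : ℕ :=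
  ((U &&& byteMask (8 - x)) <<< x) ||| ((U >>> (8 - x)) &&& byteMask x)

/-- Rotate a 32-bit mask by `y` bytes. -/
def rotHigh (y U : ℕ) : ℕ :=
  ((U &&& (2 ^ (32 - 8 * y) - 1)) <<< (8 * y)) ||| ((U >>> (32 - 8 * y)) &&& (2 ^ (8 * y) - 1))

/-- Translate a set of coded residues by the residue with code `v`. -/
def translate (v U : ℕ) : ℕ := rotHigh (v / 8) (rotLow (v % 8) U)

/-- A class of units modulo `d`-th powers: the codes `v` and `s v` of its two residues, and
whether the class is congruent to `1 + π` rather than to `1` modulo `π²`. -/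
structure UnitClass where
  fst : ℕ
  snd : ℕ
  odd : Bool
deriving DecidableEq

/-- The sums that become available when one more term of class `g` may be added. -/
def extend (g : UnitClass) (U : ℕ) : ℕ :=
  U ||| translate g.fst U ||| translate g.snd U ||| 1 <<< g.fst ||| 1 <<< g.snd

/-- The residues whose product with `π` lies in `U`. -/
def divPi (P Q U : ℕ) : ℕ :=
  (List.range 32).foldl (fun r y => bif U.testBit (mulCode P Q 8 y) then r ||| 1 <<< y else r) 0

/-- Check `leaf n t V` for every set `V` that results from `U` by adding terms of the classes `gs`,
in this order and with repetitions, as long as no zero sum occurs. Here `n` counts the terms and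
`t` those of an odd class. -/
def explore (leaf : ℕ → ℕ → ℕ → Bool) : ℕ → List UnitClass → ℕ → ℕ → ℕ → Bool
  | 0, _, _, _, _ => false
  | _ + 1, [], n, t, U => leaf n t U
  | f + 1, g :: gs, n, t, U =>
    explore leaf f gs n t U &&
      force (extend g U) fun V =>
        V.testBit 0 || explore leaf f (g :: gs) (n + 1) (bif g.odd then t + 1 else t) V

/-- Every step from a state listed in `T` leads to a state listed in `T`, and the labels of the
two states satisfy `good`. -/
def verify (P Q : ℕ) (gs : List UnitClass) (good : ℕ → ℕ → ℕ → ℕ → Bool) (T : List (ℕ × ℕ)) :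
    Bool :=
  T.all fun p => explore
    (fun n t U => force (divPi P Q U) fun V => T.any fun q => Nat.beq q.1 V && good n t p.2 q.2)
    -- Fuel 16 covers eight skipped classes and up to seven terms at one level. Exhausted fuel
    -- counts as failure, so a successful check shows that it suffices.
    16 gs 0 0 p.1

/-- The unit classes with the given representatives. -/
def classes (P Q : ℕ) (reps : List ℕ) : List UnitClass :=
  reps.map fun v => ⟨v, mulCode P Q v (mulCode P Q 9 9), (v / 8).testBit 0⟩

/-- One code from each of the eight pairs `{v, s v}` among the sixteen unit residues; the name of a
list records `P` and `Q`. -/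
def repsTwoZero : List ℕ := [1, 3, 5, 7, 9, 11, 25, 27]
def repsSixTwo : List ℕ := [1, 3, 9, 11, 13, 15, 17, 19]
def repsTwoTwo : List ℕ := [1, 5, 9, 11, 13, 15, 17, 21]

/-- One level with `n` terms raises a potential by at most `1 - n`. -/
def goodUnit (n _ e e' : ℕ) : Bool := Nat.ble (n + e') (e + 1)

/-- The labels are `4Φ + λ`. One level with `n` terms raises `Φ` by at most `7 (3 - 2 n)`, and in
the case of equality `λ` increases by one modulo four and governs the parity of the classes. -/
def goodThreeHalves (n t e e' : ℕ) : Bool :=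
  Nat.ble (14 * n + e' / 4 + 1) (e / 4 + 21) ||
    (Nat.beq (14 * n + e' / 4) (e / 4 + 21) && Nat.beq (e' % 4) ((e % 4 + 1) % 4) &&
      (!Nat.beq (e % 4) 0 || Nat.beq t 0) && (!Nat.beq (e % 4) 2 || Nat.ble 1 t))

/-- The reachable states and their labels for `π² ≡ 2`. -/
def statesTwoZero : List (ℕ × ℕ) := [
    (0, 256), (2271880, 176), (8956450, 176), (11141290, 176), (15597806, 76), (285217092, 132),
    (286331136, 52), (289673472, 128), (289673540, 128), (291945352, 72), (296358314, 156),
    (298629922, 72), (1140868164, 128), (1141982208, 52), (1143140044, 72), (1145324544, 132),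
    (1145324612, 128), (1149824614, 72), (1152009386, 154), (1153167018, 44), (1426085120, 156),
    (1427199300, 44), (1431655680, 44), (1431655748, 0), (1433927628, 0), (1437226410, 154),
    (1440612198, 0), (2852170240, 176), (2854355080, 176), (2856626756, 76), (2861039650, 176),
    (2863311530, 176), (3137387264, 152), (3140729736, 44), (3144028552, 72), (3147414306, 44),
    (3148528622, 76), (3149642666, 0), (3150713122, 72), (3152985002, 69), (3152985070, 69),
    (3993038336, 156), (3995223244, 72), (4001907814, 72), (4004179694, 71), (4005250218, 44),
    (4005293738, 0), (4008636074, 76), (4008636142, 71), (4278255360, 152), (4286010828, 0),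
    (4289396650, 96), (4290510830, 0), (4292695398, 0), (4293853166, 16), (4294967210, 0),
    (4294967278, 0)]

/-- The reachable states and their labels for `π² ≡ 6 + 2π`. -/
def statesSixTwo : List (ℕ × ℕ) := [
    (0, 3), (11141290, 2), (15597806, 1), (285217092, 2), (286331136, 1), (289673472, 2),
    (296358314, 2), (570460330, 2), (581601280, 2), (871274922, 1), (1140868164, 2),
    (1141982208, 1), (1145324544, 2), (1152009386, 2), (1426085120, 2), (1431655748, 0),
    (1437226410, 2), (1726925994, 1), (2281710250, 2), (2292851200, 2), (2582524842, 1),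
    (2852170240, 2), (2856626756, 1), (2863311530, 2), (3137387264, 2), (3137387502, 1),
    (3148528452, 1), (3148528622, 1), (3149642666, 0), (3152985002, 1), (3152985070, 1),
    (3438175914, 1), (3993038336, 2), (3993038574, 1), (4004179524, 1), (4004179694, 1),
    (4005293738, 0), (4008636074, 1), (4008636142, 1), (4278255360, 2), (4289396650, 1),
    (4293853166, 0), (4294967278, 0)]

/-- The reachable states and their labels for `π² ≡ 2 + 2π`. -/
def statesTwoTwo : List (ℕ × ℕ) := [
    (0, 4), (11141290, 3), (15597806, 2), (285217092, 3), (286331136, 2), (289673472, 3),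
    (296358314, 3), (570460330, 3), (581601280, 3), (856791466, 2), (866818542, 2),
    (867932416, 2), (1140868164, 3), (1141982208, 2), (1145324544, 3), (1152009386, 3),
    (1426085120, 3), (1427199300, 2), (1431655680, 2), (1431655748, 1), (1437226410, 3),
    (1712442538, 2), (1722469614, 2), (1723583488, 2), (2281710250, 3), (2292851200, 3),
    (2568041386, 2), (2578068462, 2), (2579182336, 2), (2852170240, 3), (2856626756, 2),
    (2863311530, 3), (3137387264, 3), (3141843882, 2), (3148528622, 2), (3149642666, 1),
    (3152984832, 2), (3152985002, 2), (3152985070, 2), (3423692458, 2), (3433719534, 2),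
    (3434833408, 2), (3993038336, 3), (3997494954, 2), (4004179694, 2), (4005293738, 1),
    (4008635904, 2), (4008636074, 2), (4008636142, 2), (4278255360, 3), (4289396650, 2),
    (4290510830, 1), (4293853166, 1), (4294967210, 1), (4294967278, 0)]

/-- A finite check: every term sequence without zero sum at one level, from every listed state,
leads back into the table with an admissible change of label. -/
theorem verify_two_zero :
    verify 2 0 (classes 2 0 repsTwoZero) goodThreeHalves statesTwoZero = true := by
  decide +kernel

theorem verify_six_two : verify 6 2 (classes 6 2 repsSixTwo) goodUnit statesSixTwo = true := by
  decide +kernel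

theorem verify_two_two : verify 2 2 (classes 2 2 repsTwoTwo) goodUnit statesTwoTwo = true := by
  decide +kernel

/-! ### Soundness of the mask operations and of the search -/

theorem testBit_byteMask :
    ∀ t ≤ 8, ∀ i < 32, (byteMask t).testBit i = true → i % 8 < t := by
  decide +kernel

theorem testBit_rotLow {x U k : ℕ} (hx : x < 8) (hk : k < 32)
    (h : (rotLow x U).testBit k = true) :
    ∃ j < 32, U.testBit j = true ∧ j / 8 = k / 8 ∧ (j % 8 + x) % 8 = k % 8 := by
  simp only [rotLow, Nat.testBit_or, Nat.testBit_and, Nat.testBit_shiftLeft, Nat.testBit_shiftRight,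
    Bool.or_eq_true, Bool.and_eq_true, decide_eq_true_eq] at h
  rcases h with ⟨h1, h2, h3⟩ | ⟨h2, h3⟩
  · have := testBit_byteMask _ (by omega) _ (by omega) h3
    exact ⟨k - x, by omega, h2, by omega, by omega⟩
  · have := testBit_byteMask _ (by omega) _ hk h3
    exact ⟨8 - x + k, by omega, h2, by omega, by omega⟩

theorem testBit_rotHigh {y U k : ℕ} (hy : y < 4) (hk : k < 32)
    (h : (rotHigh y U).testBit k = true) :
    ∃ j < 32, U.testBit j = true ∧ j % 8 = k % 8 ∧ (j / 8 + y) % 4 = k / 8 := by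
  simp only [rotHigh, Nat.testBit_or, Nat.testBit_and, Nat.testBit_shiftLeft,
    Nat.testBit_shiftRight, Nat.testBit_two_pow_sub_one, Bool.or_eq_true, Bool.and_eq_true,
    decide_eq_true_eq] at h
  rcases h with ⟨h1, h2, h3⟩ | ⟨h2, h3⟩
  · exact ⟨k - 8 * y, by omega, h2, by omega, by omega⟩
  · exact ⟨32 - 8 * y + k, by omega, h2, by omega, by omega⟩

/-- The byte index of a code is the coefficient of `π`, the position inside the byte is the constant
coefficient; adding a residue rotates both. Only this direction is needed: each bit must come from a
genuine sum, while a missing bit would do no harm. -/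
theorem testBit_translate {v U k : ℕ} (hv : v < 32) (hk : k < 32)
    (h : (translate v U).testBit k = true) :
    ∃ j < 32, U.testBit j = true ∧ addCode j v = k := by
  obtain ⟨i, hi, h1, h2, h3⟩ := testBit_rotHigh (by omega) hk h
  obtain ⟨j, hj, h4, h5, h6⟩ := testBit_rotLow (by omega) hi h1
  refine ⟨j, hj, h4, ?_⟩
  unfold addCode
  omega

theorem testBit_extend {g : UnitClass} {U k : ℕ} (h1 : g.fst < 32) (h2 : g.snd < 32) (hk : k < 32)
    (h : (extend g U).testBit k = true) :
    U.testBit k = true ∨ ∃ v, (v = g.fst ∨ v = g.snd) ∧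
      (v = k ∨ ∃ j < 32, U.testBit j = true ∧ addCode j v = k) := by
  have hone : ∀ v, (1 <<< v : ℕ).testBit k = true → v = k := by
    intro v hv
    rw [Nat.one_shiftLeft, Nat.testBit_two_pow] at hv
    simpa using hv
  simp only [extend, Nat.testBit_or, Bool.or_eq_true] at h
  rcases h with (((h | h) | h) | h) | h
  · exact .inl h
  · exact .inr ⟨g.fst, .inl rfl, .inr (testBit_translate h1 hk h)⟩
  · exact .inr ⟨g.snd, .inr rfl, .inr (testBit_translate h2 hk h)⟩
  · exact .inr ⟨g.fst, .inl rfl, .inl (hone _ h)⟩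
  · exact .inr ⟨g.snd, .inr rfl, .inl (hone _ h)⟩

theorem testBit_divPi {P Q U y : ℕ} (h : (divPi P Q U).testBit y = true) :
    y < 32 ∧ U.testBit (mulCode P Q 8 y) = true := by
  have key : ∀ (l : List ℕ) (r : ℕ),
      (l.foldl (fun r y => bif U.testBit (mulCode P Q 8 y) then r ||| 1 <<< y else r) r).testBit y
        = true → r.testBit y = true ∨ y ∈ l ∧ U.testBit (mulCode P Q 8 y) = true := by
    intro l
    induction l with
    | nil => intro r hr; exact .inl hr
    | cons a l ih =>
      intro r hr
      rw [List.foldl_cons] at hr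
      rcases ih _ hr with h' | h'
      · cases hb : U.testBit (mulCode P Q 8 a)
        · rw [hb] at h'
          exact .inl h'
        · rw [hb, cond_true, Nat.testBit_or, Bool.or_eq_true] at h'
          rcases h' with h' | h'
          · exact .inl h'
          · rw [Nat.one_shiftLeft, Nat.testBit_two_pow] at h'
            have : a = y := by simpa using h'
            subst this
            exact .inr ⟨by simp, hb⟩
      · exact .inr ⟨by simp [h'.1], h'.2⟩
  rcases key _ _ h with h' | ⟨h', h''⟩
  · simp at h'
  · exact ⟨by simpa using h', h''⟩

/-- The word `w` runs through letters of `gs` in the order of `gs`. -/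
def Follows : List UnitClass → List UnitClass → Prop
  | _, [] => True
  | [], _ :: _ => False
  | g :: gs, x :: w => (x = g ∧ Follows (g :: gs) w) ∨ Follows gs (x :: w)
termination_by gs w => gs.length + w.length

theorem follows_nil (gs : List UnitClass) : Follows gs [] := by
  cases gs <;> simp [Follows]

theorem Follows.cons {g : UnitClass} {gs w : List UnitClass} (h : Follows gs w) :
    Follows (g :: gs) w := by
  cases w with
  | nil => exact follows_nil _
  | cons x w => rw [Follows]; exact .inr h

theorem Follows.replicate_append {g : UnitClass} {gs w : List UnitClass} (h : Follows gs w)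
    (k : ℕ) : Follows (g :: gs) (List.replicate k g ++ w) := by
  induction k with
  | zero => exact h.cons
  | succ k ih =>
    rw [List.replicate_succ, List.cons_append, Follows]
    exact .inl ⟨rfl, ih⟩

theorem follows_flatMap (gs : List UnitClass) (k : UnitClass → ℕ) :
    Follows gs (gs.flatMap fun g => List.replicate (k g) g) := by
  induction gs with
  | nil => exact follows_nil _
  | cons g gs ih => exact ih.replicate_append (k g)

/-- The sums available after adding terms of the classes in `w`. -/
def extendList (w : List UnitClass) (U : ℕ) : ℕ := w.foldl (fun V g => extend g V) U

/-- The word traces one branch of the search tree. The cut at a zero sum never ends this branch,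
because no prefix of the word produces the bit 0. -/
theorem explore_sound (leaf : ℕ → ℕ → ℕ → Bool) (f : ℕ) (gs : List UnitClass) :
    ∀ (n t U : ℕ) (w : List UnitClass), explore leaf f gs n t U = true → Follows gs w →
      (∀ p, p <+: w → (extendList p U).testBit 0 = false) →
      leaf (n + w.length) (t + w.countP (·.odd)) (extendList w U) = true := by
  induction f generalizing gs with
  | zero => intro n t U w h; simp [explore] at h
  | succ f ih =>
    intro n t U w h hw h0
    cases gs with
    | nil =>
      cases w with
      | nil => simpa [explore, extendList] using h
      | cons x w => simp [Follows] at hw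
    | cons g gs =>
      rw [explore, Bool.and_eq_true, force_eq, Bool.or_eq_true] at h
      have skip : Follows gs w → leaf (n + w.length) (t + w.countP (·.odd)) (extendList w U) :=
        fun hw => ih gs n t U w h.1 hw h0
      cases w with
      | nil => exact skip (follows_nil _)
      | cons x w =>
        rw [Follows] at hw
        rcases hw with ⟨rfl, hw⟩ | hw
        · have h1 : (extend x U).testBit 0 = false := h0 [x] (by simp)
          rcases h.2 with h2 | h2
          · rw [h1] at h2
            cases h2
          · have := ih (x :: gs) _ _ _ w h2 hw fun p hp => h0 (x :: p) (by simpa using hp)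
            have e1 : n + 1 + w.length = n + (x :: w).length := by simp; omega
            have e2 : (bif x.odd then t + 1 else t) + w.countP (·.odd)
                = t + (x :: w).countP (·.odd) := by
              rw [List.countP_cons]
              cases x.odd <;> simp; omega
            rw [e1, e2] at this
            exact this
        · exact skip hw

theorem verify_sound {P Q : ℕ} {gs : List UnitClass} {good : ℕ → ℕ → ℕ → ℕ → Bool}
    {T : List (ℕ × ℕ)} (h : verify P Q gs good T = true) {U e : ℕ} (hU : (U, e) ∈ T)
    {w : List UnitClass} (hw : Follows gs w)
    (h0 : ∀ p, p <+: w → (extendList p U).testBit 0 = false) :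
    ∃ e', (divPi P Q (extendList w U), e') ∈ T ∧
      good w.length (w.countP (·.odd)) e e' = true := by
  rw [verify, List.all_eq_true] at h
  have := explore_sound _ _ _ _ _ _ w (h _ hU) hw h0
  rw [force_eq, List.any_eq_true] at this
  obtain ⟨⟨V, e'⟩, hV, hg⟩ := this
  rw [Bool.and_eq_true] at hg
  obtain ⟨hV', hg⟩ := hg
  obtain rfl := Nat.eq_of_beq_eq_true hV'
  exact ⟨e', hV, by simpa using hg⟩

/-- The state before level `L` when the terms at level `L` have the classes `w L`. -/
def state (P Q : ℕ) (w : ℕ → List UnitClass) : ℕ → ℕ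
  | 0 => 0
  | L + 1 => divPi P Q (extendList (w L) (state P Q w L))

theorem exists_labels {P Q : ℕ} {gs : List UnitClass} {good : ℕ → ℕ → ℕ → ℕ → Bool}
    {T : List (ℕ × ℕ)} (h : verify P Q gs good T = true) {e₀ : ℕ} (hT : (0, e₀) ∈ T)
    {w : ℕ → List UnitClass} (hw : ∀ L, Follows gs (w L))
    (h0 : ∀ L p, p <+: w L → (extendList p (state P Q w L)).testBit 0 = false) :
    ∃ e : ℕ → ℕ, ∀ L, good (w L).length ((w L).countP (·.odd)) (e L) (e (L + 1)) = true := by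
  have step : ∀ L (e : {e // (state P Q w L, e) ∈ T}),
      ∃ e' : {e // (state P Q w (L + 1), e) ∈ T},
        good (w L).length ((w L).countP (·.odd)) e.1 e'.1 = true := fun L e =>
    let ⟨e', h1, h2⟩ := verify_sound h e.2 (hw L) (h0 L)
    ⟨⟨e', h1⟩, h2⟩
  choose next hnext using step
  let e : ∀ L, {e // (state P Q w L, e) ∈ T} := fun L =>
    Nat.rec ⟨e₀, hT⟩ (fun L e => next L e) L
  exact ⟨fun L => (e L).1, fun L => hnext L (e L)⟩

/-! ### Contradictions from summing labels over periods -/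

theorem sum_range_mul_of_periodic {d s : ℕ} {n : ℕ → ℕ} (hn : ∀ L, n (L + d) = n L)
    (hs : ∑ L ∈ Finset.range d, n L = s) (a : ℕ) :
    ∑ L ∈ Finset.range d, n (a * d + L) = s := by
  rw [← hs]
  refine Finset.sum_congr rfl fun L _ => ?_
  induction a with
  | zero => simp
  | succ a ih => rw [← ih, ← hn (a * d + L)]; congr 1; ring

/-- Over a period the potential changes by at most `d - (d + 1) = -1`, which a natural number cannot
sustain. -/
theorem not_goodUnit {d : ℕ} {n t e : ℕ → ℕ} (hn : ∀ L, n (L + d) = n L)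
    (hs : ∑ L ∈ Finset.range d, n L = d + 1)
    (h : ∀ L, goodUnit (n L) (t L) (e L) (e (L + 1)) = true) : False := by
  simp only [goodUnit, Nat.ble_eq] at h
  have tele : ∀ a N, ∑ L ∈ Finset.range N, n (a + L) + e (a + N) ≤ e a + N := by
    intro a N
    induction N with
    | zero => simp
    | succ N ih =>
      rw [Finset.sum_range_succ]
      have := h (a + N)
      rw [← add_assoc]
      omega
  have per : ∀ N, e (N * d) + N ≤ e 0 := by
    intro N
    induction N with
    | zero => simp
    | succ N ih =>
      have := tele (N * d) d
      rw [sum_range_mul_of_periodic hn hs] at this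
      rw [add_mul, one_mul]
      omega
  have := per (e 0 + 1)
  omega

/-- Write a label as `4Φ + λ`. A period changes `Φ` by at most `21 d - 14 · 3 m = 0`, so from some
period on there is no loss and every step is tight. Then `λ` increases by one at each level. Where
`λ = 0` there is no term of odd class; one period later `λ = 2`, as `d ≡ 2` modulo 4, and there must
be one. This contradicts periodicity. -/
theorem not_goodThreeHalves {m d : ℕ} (hd : d = 2 * m) (hm : Odd m) (hm3 : 3 ≤ m) {n t e : ℕ → ℕ}
    (hn : ∀ L, n (L + d) = n L) (ht : ∀ L, t (L + d) = t L)
    (hs : ∑ L ∈ Finset.range d, n L = 3 * m)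
    (h : ∀ L, goodThreeHalves (n L) (t L) (e L) (e (L + 1)) = true) : False := by
  have beq : ∀ {a b : ℕ}, Nat.beq a b = true ↔ a = b := fun {a b} => by
    rw [Nat.beq_eq]
  have nbeq : ∀ {a b : ℕ}, Nat.beq a b = false ↔ a ≠ b := fun {a b} => by
    rw [← Bool.not_eq_true, beq]
  simp only [goodThreeHalves, Bool.or_eq_true, Bool.and_eq_true, Nat.ble_eq, beq,
    Bool.not_eq_true', nbeq] at h
  have tele : ∀ a N, 14 * ∑ L ∈ Finset.range N, n (a + L) + e (a + N) / 4 ≤ e a / 4 + 21 * N := by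
    intro a N
    induction N with
    | zero => simp
    | succ N ih =>
      rw [Finset.sum_range_succ]
      have := h (a + N)
      rw [← add_assoc]
      omega
  have tele' : ∀ a N, 14 * ∑ L ∈ Finset.range N, n (a + L) + e (a + N) / 4 = e a / 4 + 21 * N →
      ∀ M ≤ N, 14 * ∑ L ∈ Finset.range M, n (a + L) + e (a + M) / 4 = e a / 4 + 21 * M := by
    intro a N hN M hM
    obtain ⟨k, rfl⟩ := Nat.exists_eq_add_of_le hM
    rw [Finset.sum_range_add, ← add_assoc a M k] at hN
    have h1 := tele a M
    have h2 := tele (a + M) k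
    simp only [← add_assoc] at hN h2
    omega
  have mono : ∀ a, e ((a + 1) * d) / 4 ≤ e (a * d) / 4 := by
    intro a
    have := tele (a * d) d
    rw [sum_range_mul_of_periodic hn hs] at this
    rw [add_mul, one_mul]
    omega
  -- At a minimum of `Φ` along the multiples of `d`, the next two periods are both tight; two are
  -- needed to compare `L` with `L + d`.
  obtain ⟨a, ha⟩ : ∃ a, ∀ b, e (a * d) / 4 ≤ e (b * d) / 4 := by
    obtain ⟨x, ⟨a, rfl⟩, hx⟩ := WellFounded.has_min (wellFounded_lt (α := ℕ))
      (Set.range fun a => e (a * d) / 4) (Set.range_nonempty _)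
    exact ⟨a, fun b => not_lt.mp (hx _ ⟨b, rfl⟩)⟩
  have e1 : e ((a + 1) * d) / 4 = e (a * d) / 4 := le_antisymm (mono a) (ha _)
  have e2 : e ((a + 1 + 1) * d) / 4 = e (a * d) / 4 :=
    le_antisymm ((mono (a + 1)).trans (mono a)) (ha _)
  set c := a * d with hc
  have tight : ∀ L < 2 * d, 14 * n (c + L) + e (c + L + 1) / 4 = e (c + L) / 4 + 21 := by
    have full : 14 * ∑ L ∈ Finset.range (2 * d), n (c + L) + e (c + 2 * d) / 4
        = e c / 4 + 21 * (2 * d) := by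
      have s1 := sum_range_mul_of_periodic hn hs a
      have s2 := sum_range_mul_of_periodic hn hs (a + 1)
      have e3 : (a + 1 + 1) * d = c + 2 * d := by rw [hc]; ring
      rw [e3] at e2
      rw [two_mul, Finset.sum_range_add]
      simp only [← add_assoc, ← two_mul]
      rw [← hc] at s1
      rw [add_mul, one_mul, ← hc] at s2
      rw [s1, s2, e2]
      omega
    intro L hL
    have h1 := tele' c (2 * d) full L (by omega)
    have h2 := tele' c (2 * d) full (L + 1) (by omega)
    rw [Finset.sum_range_succ, ← add_assoc c] at h2
    omega
  have lam : ∀ L ≤ 2 * d, e (c + L) % 4 = (e c % 4 + L) % 4 := by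
    intro L
    induction L with
    | zero => simp
    | succ L ih =>
      intro hL
      have h1 := tight L (by omega)
      have h2 := h (c + L)
      have h3 := ih (by omega)
      rw [← add_assoc]
      omega
  obtain ⟨k, hk⟩ := hm
  obtain ⟨L, hL4, hL⟩ : ∃ L < 4, (e c % 4 + L) % 4 = 0 := ⟨(4 - e c % 4) % 4, by omega, by omega⟩
  have h1 := h (c + L)
  have h2 := h (c + L + d)
  have l1 := lam L (by omega)
  have l2 := lam (L + d) (by omega)
  have g1 := tight L (by omega)
  have g2 := tight (L + d) (by omega)
  rw [← add_assoc] at l2 g2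
  rw [ht] at h2
  omega

/-! ### Ultrametric approximation -/

section Near

variable {K : Type*} [NormedField K]

/-- `x` and `y` have distance at most `r`. -/
def Near (r : ℝ) (x y : K) : Prop := ‖x - y‖ ≤ r

theorem Near.refl {r : ℝ} (hr : 0 ≤ r) (x : K) : Near r x x := by simpa [Near] using hr

theorem Near.symm {r : ℝ} {x y : K} (h : Near r x y) : Near r y x := by
  rwa [Near, norm_sub_rev]

theorem Near.mono {r r' : ℝ} (hr : r ≤ r') {x y : K} (h : Near r x y) : Near r' x y := le_trans h hr

theorem Near.mul_left {r : ℝ} {x y : K} (h : Near r x y) (c : K) :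
    Near (‖c‖ * r) (c * x) (c * y) := by
  rw [Near, ← mul_sub, norm_mul]
  exact mul_le_mul_of_nonneg_left h (norm_nonneg c)

variable [IsUltrametricDist K]

theorem Near.trans {r : ℝ} {x y z : K} (h : Near r x y) (h' : Near r y z) : Near r x z := by
  rw [Near, ← sub_add_sub_cancel x y z]
  exact (IsUltrametricDist.norm_add_le_max _ _).trans (max_le h h')

theorem Near.add {r : ℝ} {x y x' y' : K} (h : Near r x y) (h' : Near r x' y') :
    Near r (x + x') (y + y') := by
  rw [Near, add_sub_add_comm]
  exact (IsUltrametricDist.norm_add_le_max _ _).trans (max_le h h')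

theorem Near.sum {r : ℝ} (hr : 0 ≤ r) {ι : Type*} {s : Finset ι} {f g : ι → K}
    (h : ∀ i ∈ s, Near r (f i) (g i)) : Near r (∑ i ∈ s, f i) (∑ i ∈ s, g i) := by
  classical
  induction s using Finset.induction_on with
  | empty => simpa using Near.refl hr 0
  | insert a s ha ih =>
    rw [Finset.sum_insert ha, Finset.sum_insert ha]
    exact (h a (by simp)).add (ih fun i hi => h i (by simp [hi]))

theorem Near.mul {r : ℝ} {x y x' y' : K} (h : Near r x y) (h' : Near r x' y')
    (hx : ‖x‖ ≤ 1) (hy : ‖y'‖ ≤ 1) : Near r (x * x') (y * y') := by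
  have e : x * x' - y * y' = x * (x' - y') + (x - y) * y' := by ring
  rw [Near, e]
  refine (IsUltrametricDist.norm_add_le_max _ _).trans (max_le ?_ ?_)
  · rw [norm_mul]
    exact (mul_le_of_le_one_left (norm_nonneg _) hx).trans h'
  · rw [norm_mul]
    exact (mul_le_of_le_one_right (norm_nonneg _) hy).trans h

theorem Near.norm_le {r : ℝ} {x y : K} (h : Near r x y) (hy : ‖y‖ ≤ r) : ‖x‖ ≤ r := by
  rw [← sub_add_cancel x y]
  exact (IsUltrametricDist.norm_add_le_max _ _).trans (max_le h hy)

theorem Near.norm_eq {r : ℝ} {x y : K} (h : Near r x y) (hy : r < ‖y‖) : ‖x‖ = ‖y‖ := by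
  have hlt : ‖x - y‖ < ‖y‖ := lt_of_le_of_lt h hy
  rw [← sub_add_cancel x y, IsUltrametricDist.norm_add_eq_max_of_norm_ne_norm hlt.ne]
  exact max_eq_right hlt.le

theorem Near.pow_one {r : ℝ} {x : K} (h : Near r x 1) (hr : 0 ≤ r) (hx : ‖x‖ ≤ 1) (k : ℕ) :
    Near r (x ^ k) 1 := by
  induction k with
  | zero => simpa using Near.refl hr 1
  | succ k ih =>
    rw [pow_succ, ← mul_one (1 : K)]
    exact ih.mul h (by rw [norm_pow]; exact pow_le_one₀ (norm_nonneg _) hx) (by simp)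

end Near

/-! ### Arithmetic of the local field modulo `π⁵`, and `d`-th powers -/

/-- `π` is a uniformizer of the field `K` with residue field of two elements in which `2`
has valuation two, and `π² ≡ P + Qπ` modulo `π⁵`. -/
structure IsModel {K : Type*} [NormedField K] (π : K) (P Q : ℕ) : Prop where
  norm_pos : 0 < ‖π‖
  norm_lt_one : ‖π‖ < 1
  exists_zpow : ∀ x : K, x ≠ 0 → ∃ n : ℤ, ‖x‖ = ‖π‖ ^ n
  residue : ∀ x : K, ‖x‖ ≤ 1 → ‖x‖ < 1 ∨ ‖x - 1‖ < 1
  norm_two : ‖(2 : K)‖ = ‖π‖ ^ 2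
  sq : Near (‖π‖ ^ 5) (π ^ 2) (P + Q * π)

/-- The element `a + bπ` with code `a + 8b`. -/
def val {K : Type*} [NormedField K] (π : K) (c : ℕ) : K := ((c % 8 : ℕ) : K) + ((c / 8 : ℕ) : K) * π

namespace IsModel

variable {K : Type*} [NormedField K] {π : K} {P Q : ℕ}

section

variable (h : IsModel π P Q)

include h

theorem ne_zero : π ≠ 0 := norm_pos_iff.mp h.norm_pos

theorem pow_pos (n : ℕ) : 0 < ‖π‖ ^ n := _root_.pow_pos h.norm_pos n

theorem pow_le {m n : ℕ} (hmn : m ≤ n) : ‖π‖ ^ n ≤ ‖π‖ ^ m :=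
  pow_le_pow_of_le_one h.norm_pos.le h.norm_lt_one.le hmn

theorem pow_lt {m n : ℕ} (hmn : m < n) : ‖π‖ ^ n < ‖π‖ ^ m :=
  pow_lt_pow_right_of_lt_one₀ h.norm_pos h.norm_lt_one hmn

theorem zpow_lt_iff {m n : ℤ} : ‖π‖ ^ m < ‖π‖ ^ n ↔ n < m :=
  zpow_lt_zpow_iff_right_of_lt_one₀ h.norm_pos h.norm_lt_one

theorem zpow_le_iff {m n : ℤ} : ‖π‖ ^ m ≤ ‖π‖ ^ n ↔ n ≤ m :=
  zpow_le_zpow_iff_right_of_lt_one₀ h.norm_pos h.norm_lt_one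

theorem norm_le_of_lt {x : K} {n : ℤ} (hx : ‖x‖ < ‖π‖ ^ n) : ‖x‖ ≤ ‖π‖ ^ (n + 1) := by
  rcases eq_or_ne x 0 with rfl | hx0
  · rw [norm_zero]
    exact (zpow_pos h.norm_pos _).le
  · obtain ⟨k, hk⟩ := h.exists_zpow x hx0
    rw [hk, h.zpow_lt_iff] at hx
    rw [hk, h.zpow_le_iff]
    exact hx

theorem norm_le_of_lt_one {x : K} (hx : ‖x‖ < 1) : ‖x‖ ≤ ‖π‖ := by
  have := h.norm_le_of_lt (n := 0) (by simpa using hx)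
  simpa using this

theorem near_one {x : K} (hx : ‖x‖ = 1) : Near ‖π‖ x 1 := by
  rcases h.residue x hx.le with h1 | h1
  · exact absurd hx h1.ne
  · exact h.norm_le_of_lt_one h1

end

section

variable [IsUltrametricDist K] (h : IsModel π P Q)

include h

theorem near_nat (a b : ℕ) : Near (‖π‖ ^ 5) ((a : K) + b * π) (val π (a % 8 + 8 * (b % 4))) := by
  have e1 : (a % 8 + 8 * (b % 4)) % 8 = a % 8 := by omega
  have e2 : (a % 8 + 8 * (b % 4)) / 8 = b % 4 := by omega
  have ea : (a : K) = ((a % 8 : ℕ) : K) + 2 ^ 3 * ((a / 8 : ℕ) : K) := by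
    conv_lhs => rw [← Nat.mod_add_div a 8]
    push_cast
    ring
  have eb : (b : K) = ((b % 4 : ℕ) : K) + 2 ^ 2 * ((b / 4 : ℕ) : K) := by
    conv_lhs => rw [← Nat.mod_add_div b 4]
    push_cast
    ring
  have e : (a : K) + b * π - val π (a % 8 + 8 * (b % 4)) =
      2 ^ 3 * ((a / 8 : ℕ) : K) + 2 ^ 2 * ((b / 4 : ℕ) : K) * π := by
    rw [val, e1, e2, ea, eb]
    ring
  rw [Near, e]
  refine (IsUltrametricDist.norm_add_le_max _ _).trans (max_le ?_ ?_)
  · rw [norm_mul, norm_pow, h.norm_two, ← pow_mul]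
    exact (mul_le_of_le_one_right (h.pow_pos _).le
      (IsUltrametricDist.norm_natCast_le_one K _)).trans (h.pow_le (by norm_num))
  · rw [norm_mul, norm_mul, norm_pow, h.norm_two, ← pow_mul, mul_right_comm, ← pow_succ]
    exact mul_le_of_le_one_right (h.pow_pos _).le (IsUltrametricDist.norm_natCast_le_one K _)

theorem norm_nat_add_le (a b : ℕ) : ‖(a : K) + b * π‖ ≤ 1 := by
  refine (IsUltrametricDist.norm_add_le_max _ _).trans
    (max_le (IsUltrametricDist.norm_natCast_le_one K _) ?_)
  rw [norm_mul]
  exact mul_le_one₀ (IsUltrametricDist.norm_natCast_le_one K _) (norm_nonneg _) h.norm_lt_one.le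

theorem norm_val_le (c : ℕ) : ‖val π c‖ ≤ 1 := h.norm_nat_add_le _ _

theorem near_addCode (j k : ℕ) : Near (‖π‖ ^ 5) (val π j + val π k) (val π (addCode j k)) := by
  have := h.near_nat (j % 8 + k % 8) (j / 8 + k / 8)
  rw [addCode]
  convert this using 1
  rw [val, val]
  push_cast
  ring

theorem near_mulCode (j k : ℕ) : Near (‖π‖ ^ 5) (val π j * val π k) (val π (mulCode P Q j k)) := by
  have := h.near_nat ((j % 8) * (k % 8) + (j / 8) * (k / 8) * P)
    ((j % 8) * (k / 8) + (j / 8) * (k % 8) + (j / 8) * (k / 8) * Q)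
  refine Near.trans ?_ this
  have e : val π j * val π k - ((((j % 8) * (k % 8) + (j / 8) * (k / 8) * P : ℕ) : K) +
      (((j % 8) * (k / 8) + (j / 8) * (k % 8) + (j / 8) * (k / 8) * Q : ℕ) : K) * π) =
      (((j / 8) * (k / 8) : ℕ) : K) * (π ^ 2 - (P + Q * π)) := by
    rw [val, val]
    push_cast
    ring
  rw [Near, e, norm_mul]
  exact (mul_le_of_le_one_left (norm_nonneg _) (IsUltrametricDist.norm_natCast_le_one K _)).trans
    h.sq

theorem exists_near_val {x : K} (hx : ‖x‖ ≤ 1) : ∃ c < 32, Near (‖π‖ ^ 5) x (val π c) := by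
  have key : ∀ n ≤ 5, ∀ x : K, ‖x‖ ≤ 1 → ∃ a b : ℕ, Near (‖π‖ ^ n) x (a + b * π) := by
    intro n
    induction n with
    | zero => intro _ x hx; exact ⟨0, 0, by simpa [Near] using hx⟩
    | succ n ih =>
      intro hn x hx
      have digit : ∃ e : ℕ, ‖x - e‖ ≤ ‖π‖ := by
        rcases h.residue x hx with h1 | h1
        · exact ⟨0, by simpa using h.norm_le_of_lt_one h1⟩
        · exact ⟨1, by simpa using h.norm_le_of_lt_one h1⟩
      obtain ⟨e, he⟩ := digit
      have hy : ‖(x - e) / π‖ ≤ 1 := by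
        rw [norm_div]
        exact div_le_one_of_le₀ he h.norm_pos.le
      obtain ⟨a, b, hab⟩ := ih (by omega) _ hy
      refine ⟨e + b * P, a + b * Q, ?_⟩
      have h1 : Near (‖π‖ ^ (n + 1)) (x - e) (π * (a + b * π)) := by
        have := hab.mul_left π
        rwa [mul_div_cancel₀ _ h.ne_zero, ← pow_succ'] at this
      -- Replacing `π²` by `P + Qπ` costs an error of size `π⁵`, which is harmless while at most
      -- five digits are wanted.
      have h2 : Near (‖π‖ ^ (n + 1)) (b * π ^ 2) (b * ((P : K) + Q * π)) := by
        refine Near.mono ?_ (h.sq.mul_left (b : K))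
        exact (mul_le_of_le_one_left (h.pow_pos _).le
          (IsUltrametricDist.norm_natCast_le_one K _)).trans (h.pow_le hn)
      have h3 := (h1.add (Near.refl (h.pow_pos _).le (e : K))).trans
        (((Near.refl (h.pow_pos _).le ((a : K) * π)).add h2).add
          (Near.refl (h.pow_pos _).le (e : K)) |> fun t => by
            convert t using 1
            ring)
      rw [sub_add_cancel] at h3
      convert h3 using 1
      push_cast
      ring
  obtain ⟨a, b, hab⟩ := key 5 le_rfl x hx
  exact ⟨a % 8 + 8 * (b % 4), by omega, hab.trans (h.near_nat a b)⟩

theorem norm_val_lt_one {c : ℕ} (hc : c % 2 = 0) : ‖val π c‖ < 1 := by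
  obtain ⟨a, ha⟩ : ∃ a, c % 8 = 2 * a := ⟨c % 8 / 2, by omega⟩
  rw [val, ha]
  refine (IsUltrametricDist.norm_add_le_max _ _).trans_lt (max_lt ?_ ?_)
  · push_cast
    rw [norm_mul, h.norm_two]
    refine (mul_le_of_le_one_right (h.pow_pos _).le
      (IsUltrametricDist.norm_natCast_le_one K _)).trans_lt ?_
    exact pow_lt_one₀ h.norm_pos.le h.norm_lt_one (by norm_num)
  · rw [norm_mul]
    exact (mul_le_of_le_one_left h.norm_pos.le
      (IsUltrametricDist.norm_natCast_le_one K _)).trans_lt h.norm_lt_one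

/-- One Newton step for the equation `z ^ d = u`. -/
theorem exists_better_root {d m : ℕ} (hd : d = 2 * m) (hm : Odd m) {u z : K} (n : ℕ)
    (hz : ‖z‖ = 1) (hu : Near (‖π‖ ^ (n + 5)) u (z ^ d)) :
    ∃ z', ‖z'‖ = 1 ∧ Near (‖π‖ ^ (n + 6)) u (z' ^ d) := by
  set c := (u - z ^ d) / π ^ (n + 5) with hc
  have hu' : u = z ^ d + π ^ (n + 5) * c := by
    rw [hc, mul_div_cancel₀ _ (pow_ne_zero _ h.ne_zero)]
    ring
  have hc1 : ‖c‖ ≤ 1 := by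
    rw [hc, norm_div, norm_pow]
    exact div_le_one_of_le₀ hu (h.pow_pos _).le
  have hr : (0 : ℝ) ≤ ‖π‖ ^ (n + 6) := (h.pow_pos _).le
  rcases h.residue c hc1 with h1 | h1
  · refine ⟨z, hz, ?_⟩
    rw [Near, hu', add_sub_cancel_left, norm_mul, norm_pow, pow_succ _ (n + 5)]
    exact mul_le_mul_of_nonneg_left (h.norm_le_of_lt_one h1) (h.pow_pos _).le
  have h1 : Near ‖π‖ c 1 := h.norm_le_of_lt_one h1
  -- As 2 has valuation two, `2 t` has valuation `n + 5`, while `t²` has valuation at least `n + 6`.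
  -- Hence squaring `1 + t` alters exactly the digit at `π ^ (n + 5)`, and the odd power `m`
  -- preserves this change.
  set t := π ^ (n + 3) with ht
  set v := 2 * t + t ^ 2 with hv
  have norm_t : ‖t‖ = ‖π‖ ^ (n + 3) := by rw [ht, norm_pow]
  have hε : Near ‖π‖ ((2 : K) / π ^ 2) 1 := by
    apply h.near_one
    rw [norm_div, norm_pow, h.norm_two, div_self (h.pow_pos _).ne']
  have hv1 : Near (‖π‖ ^ (n + 6)) v (π ^ (n + 5)) := by
    have a1 : Near (‖π‖ ^ (n + 6)) (2 * t) (π ^ (n + 5)) := by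
      have := hε.mul_left (π ^ (n + 5))
      rw [norm_pow, ← pow_succ, mul_one, mul_div_assoc', pow_add π (n + 3) 2] at this
      rwa [show π ^ (n + 3) * π ^ 2 * 2 / π ^ 2 = 2 * t by
        rw [ht]; field_simp [h.ne_zero], ← pow_add] at this
    have a2 : Near (‖π‖ ^ (n + 6)) (t ^ 2) 0 := by
      rw [Near, sub_zero, norm_pow, norm_t, ← pow_mul]
      exact h.pow_le (by omega)
    simpa using a1.add a2
  have norm_v : ‖v‖ ≤ ‖π‖ ^ (n + 5) :=
    (hv1.mono (h.pow_le (by omega))).norm_le (by rw [norm_pow])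
  have hpow : Near (‖π‖ ^ (n + 6)) ((1 + t) ^ d) (1 + π ^ (n + 5)) := by
    obtain ⟨k, rfl⟩ := hm
    have e : (1 + t) ^ d = ((1 + v) ^ 2) ^ k * (1 + v) := by
      rw [hd, pow_mul, show (1 + t) ^ 2 = 1 + v by rw [hv]; ring, pow_succ, pow_mul]
    have norm1v : ‖1 + v‖ ≤ 1 := by
      refine (IsUltrametricDist.norm_add_le_max _ _).trans (max_le (by simp) ?_)
      exact norm_v.trans (pow_le_one₀ h.norm_pos.le h.norm_lt_one.le)
    have b1 : Near (‖π‖ ^ (n + 6)) ((1 + v) ^ 2) 1 := by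
      rw [Near, show (1 + v) ^ 2 - 1 = 2 * v + v ^ 2 by ring]
      refine (IsUltrametricDist.norm_add_le_max _ _).trans (max_le ?_ ?_)
      · rw [norm_mul, h.norm_two]
        refine (mul_le_mul_of_nonneg_left norm_v (h.pow_pos _).le).trans ?_
        rw [← pow_add]
        exact h.pow_le (by omega)
      · rw [norm_pow]
        refine (pow_le_pow_left₀ (norm_nonneg _) norm_v 2).trans ?_
        rw [← pow_mul]
        exact h.pow_le (by omega)
    have b2 := b1.pow_one hr (by rw [norm_pow]; exact pow_le_one₀ (norm_nonneg _) norm1v) k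
    rw [e, ← one_mul (1 + π ^ (n + 5))]
    refine b2.mul ((Near.refl hr 1).add hv1) ?_ ?_
    · rw [norm_pow, norm_pow]
      exact pow_le_one₀ (by positivity) (pow_le_one₀ (norm_nonneg _) norm1v)
    · refine (IsUltrametricDist.norm_add_le_max _ _).trans (max_le (by simp) ?_)
      rw [norm_pow]
      exact pow_le_one₀ h.norm_pos.le h.norm_lt_one.le
  have norm1t : ‖1 + t‖ = 1 := by
    have : Near (‖t‖) (1 + t) 1 := by rw [Near, add_sub_cancel_left]
    rw [this.norm_eq, norm_one]
    rw [norm_t, norm_one]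
    exact pow_lt_one₀ h.norm_pos.le h.norm_lt_one (by omega)
  have hzd : ‖z ^ d‖ = 1 := by rw [norm_pow, hz, one_pow]
  refine ⟨z * (1 + t), by rw [norm_mul, hz, norm1t, one_mul], ?_⟩
  have c1 : Near (‖π‖ ^ (n + 6)) (z ^ d * (1 + t) ^ d) (z ^ d * (1 + π ^ (n + 5))) := by
    have := hpow.mul_left (z ^ d)
    rwa [hzd, one_mul] at this
  have c2 : Near (‖π‖ ^ (n + 6)) (π ^ (n + 5) * c) (π ^ (n + 5) * z ^ d) := by
    have := (h1.trans (h.near_one hzd).symm).mul_left (π ^ (n + 5))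
    rwa [norm_pow, ← pow_succ] at this
  rw [mul_pow]
  refine Near.trans ?_ c1.symm
  rw [hu', mul_add, mul_one, mul_comm (z ^ d) (π ^ _)]
  exact (Near.refl hr _).add c2

/-- Units close to one are `d`-th powers. -/
theorem exists_root [ProperSpace K] {d m : ℕ} (hd : d = 2 * m) (hm : Odd m) {u : K}
    (hu : Near (‖π‖ ^ 5) u 1) : ∃ z, z ^ d = u := by
  have approx : ∀ n, ∃ z, ‖z‖ = 1 ∧ Near (‖π‖ ^ (n + 5)) u (z ^ d) := by
    intro n
    induction n with
    | zero => exact ⟨1, norm_one, by simpa using hu⟩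
    | succ n ih =>
      obtain ⟨z, hz, hzu⟩ := ih
      exact h.exists_better_root hd hm n hz hzu
  -- The `d`-th powers of the compact unit ball form a closed set, so approximate roots of every
  -- precision suffice.
  have hclosed : IsClosed ((fun z : K => z ^ d) '' Metric.closedBall 0 1) :=
    ((isCompact_closedBall (0 : K) 1).image (continuous_pow d)).isClosed
  have hmem : u ∈ closure ((fun z : K => z ^ d) '' Metric.closedBall 0 1) := by
    rw [Metric.mem_closure_iff]
    intro ε hε
    obtain ⟨n, hn⟩ := exists_pow_lt_of_lt_one hε h.norm_lt_one
    obtain ⟨z, hz, hzu⟩ := approx n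
    refine ⟨z ^ d, ⟨z, by simp [hz], rfl⟩, ?_⟩
    rw [dist_eq_norm]
    exact (le_trans hzu (h.pow_le (by omega))).trans_lt hn
  rw [hclosed.closure_eq] at hmem
  obtain ⟨z, -, hz⟩ := hmem
  exact ⟨z, hz⟩

end

end IsModel

namespace IsModel

variable {K : Type*} [NormedField K] [IsUltrametricDist K] {π : K} {P Q : ℕ}

/-- Every unit belongs to one of the classes of `gs`, up to `d`-th powers. -/
theorem exists_class (h : IsModel π P Q) {gs : List UnitClass} {s : ℕ} (hs : s = mulCode P Q 9 9)
    (hss : mulCode P Q s s = 1)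
    (hgs : ∀ t < 32, t % 2 = 1 → ∃ g ∈ gs, (g.fst = t ∧ g.snd = mulCode P Q t s) ∨
      (g.snd = t ∧ g.fst = mulCode P Q t s))
    {d m : ℕ} (hd : d = 2 * m) (hm : Odd m) {u : K} (hu : ‖u‖ = 1) :
    ∃ g ∈ gs, ∀ v, v = g.fst ∨ v = g.snd →
      ∃ w : K, ‖w‖ = 1 ∧ Near (‖π‖ ^ 5) (u * w ^ d) (val π v) := by
  obtain ⟨t, ht, hut⟩ := h.exists_near_val hu.le
  have hr : (0 : ℝ) ≤ ‖π‖ ^ 5 := (h.pow_pos _).le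
  have hodd : t % 2 = 1 := by
    by_contra hne
    have h1 := h.norm_val_lt_one (c := t) (by omega)
    have h2 := hut.symm.norm_eq (by
      rw [hu]
      exact pow_lt_one₀ h.norm_pos.le h.norm_lt_one (by norm_num))
    rw [h2, hu] at h1
    exact lt_irrefl _ h1
  have hval : val π 9 = 1 + π := by norm_num [val]
  have hval1 : val π 1 = 1 := by norm_num [val]
  have norm1p : ‖1 + π‖ = 1 := by
    have : Near ‖π‖ (1 + π) 1 := by rw [Near, add_sub_cancel_left]
    rw [this.norm_eq (by simpa using h.norm_lt_one), norm_one]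
  have hsq : Near (‖π‖ ^ 5) ((1 + π) ^ 2) (val π s) := by
    have := h.near_mulCode 9 9
    rwa [hval, ← pow_two, ← hs] at this
  have hfour : Near (‖π‖ ^ 5) (((1 + π) ^ 2) ^ 2) 1 := by
    rw [pow_two ((1 + π) ^ 2)]
    have := h.near_mulCode s s
    rw [hss, hval1] at this
    exact (hsq.mul hsq (by rw [norm_pow, norm1p, one_pow]) (h.norm_val_le s)).trans this
  -- Since `s² = 1` and `m` is odd, `(1 + π)^d ≡ s ^ m = s`. Thus `w = 1` and `w = 1 + π` realise
  -- the two residues of the class.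
  have hpow : Near (‖π‖ ^ 5) ((1 + π) ^ d) (val π s) := by
    obtain ⟨k, rfl⟩ := hm
    rw [hd, pow_mul, pow_succ _ (2 * k), pow_mul ((1 + π) ^ 2) 2 k, ← one_mul (val π s)]
    refine (hfour.pow_one hr ?_ k).mul hsq ?_ (h.norm_val_le s)
    · rw [norm_pow, norm_pow, norm1p, one_pow, one_pow]
    · rw [norm_pow, norm_pow, norm_pow, norm1p, one_pow, one_pow, one_pow]
  have hA : ∃ w : K, ‖w‖ = 1 ∧ Near (‖π‖ ^ 5) (u * w ^ d) (val π t) :=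
    ⟨1, norm_one, by simpa using hut⟩
  have hB : ∃ w : K, ‖w‖ = 1 ∧ Near (‖π‖ ^ 5) (u * w ^ d) (val π (mulCode P Q t s)) :=
    ⟨1 + π, norm1p, (hut.mul hpow hu.le (h.norm_val_le s)).trans (h.near_mulCode t s)⟩
  obtain ⟨g, hg, hcase⟩ := hgs t ht hodd
  refine ⟨g, hg, fun v hv => ?_⟩
  rcases hcase with ⟨h1, h2⟩ | ⟨h1, h2⟩ <;> rcases hv with rfl | rfl
  · rwa [h1]
  · rwa [h2]
  · rwa [h2]
  · rwa [h1]

/-- A sum of terms that is small in comparison with one of them can be corrected to zero. -/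
theorem exists_zero_of_near (h : IsModel π P Q) [ProperSpace K] {d m : ℕ} (hd : d = 2 * m)
    (hm : Odd m) {ι : Type*} [Fintype ι] [DecidableEq ι] {a x : ι → K} {i : ι} {r : ℝ}
    (hr : 0 < r) (hi : ‖a i * x i ^ d‖ = r) (hx : ‖∑ j, a j * x j ^ d‖ ≤ r * ‖π‖ ^ 5) :
    ∃ y : ι → K, y ≠ 0 ∧ ∑ j, a j * y j ^ d = 0 := by
  set T := a i * x i ^ d with hT
  set R := ∑ j, a j * x j ^ d with hR
  have hT0 : T ≠ 0 := norm_pos_iff.mp (hi ▸ hr)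
  have hd0 : d ≠ 0 := by
    obtain ⟨k, rfl⟩ := hm
    omega
  have hxi : x i ≠ 0 := by
    rintro h0
    rw [hT, h0, zero_pow hd0, mul_zero] at hT0
    exact hT0 rfl
  -- Replacing the term `T` by `T - R = T (1 - R / T)` makes the sum vanish, and the factor `1 - R /
  -- T` is a `d`-th power.
  have hnear : Near (‖π‖ ^ 5) (1 - R / T) 1 := by
    rw [Near, sub_sub_cancel_left, norm_neg, norm_div, hi, div_le_iff₀ hr, mul_comm]
    exact hx
  obtain ⟨t, ht⟩ := h.exists_root hd hm hnear
  have ht0 : t ≠ 0 := by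
    rintro rfl
    rw [zero_pow hd0] at ht
    rw [← ht, Near, zero_sub, norm_neg, norm_one] at hnear
    exact absurd hnear (not_le.mpr (pow_lt_one₀ h.norm_pos.le h.norm_lt_one (by norm_num)))
  refine ⟨Function.update x i (t * x i), ?_, ?_⟩
  · intro h0
    have := congrFun h0 i
    rw [Function.update_self, Pi.zero_apply] at this
    exact mul_ne_zero ht0 hxi this
  · have e1 := Finset.add_sum_erase Finset.univ
      (fun j => a j * Function.update x i (t * x i) j ^ d) (Finset.mem_univ i)
    have e2 := Finset.add_sum_erase Finset.univ (fun j => a j * x j ^ d) (Finset.mem_univ i)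
    have e3 : ∑ j ∈ Finset.univ.erase i, a j * Function.update x i (t * x i) j ^ d =
        ∑ j ∈ Finset.univ.erase i, a j * x j ^ d := by
      refine Finset.sum_congr rfl fun j hj => ?_
      rw [Function.update_of_ne (Finset.ne_of_mem_erase hj)]
    rw [← e1, e3]
    simp only [Function.update_self]
    have e4 : ∑ j ∈ Finset.univ.erase i, a j * x j ^ d = R - T := by
      rw [hR, hT, ← e2]
      ring
    rw [e4, mul_pow, mul_left_comm, ← hT, ht, sub_mul, div_mul_cancel₀ _ hT0]
    ring

end IsModel

/-! ### From an anisotropic form to a walk through the states -/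

/-- Before level `L`, and after the variables in `S` have been admitted at this level, some sum of
terms is `π ^ L` times the residue with code `k`, modulo a power of `π` that allows to correct a
zero residue to a zero. The variable `i` has the levels `L` with `L ≡ n i` modulo `d`. -/
def Reach {K ι : Type*} [NormedField K] [Fintype ι] (π : K) (d : ℕ) (a : ι → K) (n : ι → ℤ)
    (L : ℕ) (S : List ι) (k : ℕ) : Prop :=
  ∃ j ≤ L, L ≤ j + 4 ∧ ∃ x : ι → K,
    (∀ i, x i ≠ 0 → i ∈ S ∨ ∃ L' < L, j ≤ L' ∧ (d : ℤ) ∣ L' - n i) ∧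
    (∃ i, ‖a i * x i ^ d‖ = ‖π‖ ^ j) ∧
    Near (‖π‖ ^ (j + 5)) (∑ i, a i * x i ^ d) (π ^ L * val π k)

theorem Reach.append {K ι : Type*} [NormedField K] [Fintype ι] {π : K} {d : ℕ} {a : ι → K}
    {n : ι → ℤ} {L : ℕ} {S : List ι} {k : ℕ}
    (hr : Reach π d a n L S k) (i : ι) :
    Reach π d a n L (S ++ [i]) k := by
  obtain ⟨j, hj, hj4, x, hx, hi, hs⟩ := hr
  refine ⟨j, hj, hj4, x, fun i' hi' => ?_, hi, hs⟩
  rcases hx i' hi' with h1 | h1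
  · exact .inl (by simp [h1])
  · exact .inr h1

theorem exists_term {K : Type*} [NormedField K] {π : K} {P Q d : ℕ} (h : IsModel π P Q) {u : K}
    {e : ℤ} {v : ℕ} {b w : K}
    (hb : b = π ^ e * u) (hu : ‖u‖ = 1) (hw : ‖w‖ = 1)
    (huw : Near (‖π‖ ^ 5) (u * w ^ d) (val π v)) {L : ℕ} (hL : (d : ℤ) ∣ L - e) :
    ∃ y : K, ‖b * y ^ d‖ = ‖π‖ ^ L ∧ Near (‖π‖ ^ (L + 5)) (b * y ^ d) (π ^ L * val π v) := by
  obtain ⟨q, hq⟩ := hL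
  refine ⟨π ^ q * w, ?_⟩
  have e1 : b * (π ^ q * w) ^ d = π ^ L * (u * w ^ d) := by
    have : π ^ L = π ^ e * (π ^ q) ^ d := by
      rw [← zpow_natCast (π ^ q), ← zpow_mul, ← zpow_add₀ h.ne_zero, ← zpow_natCast]
      congr 1
      linarith
    rw [hb, this]
    ring
  rw [e1]
  constructor
  · rw [norm_mul, norm_mul, norm_pow, norm_pow, hu, hw, one_pow, one_mul, mul_one]
  · have := huw.mul_left (π ^ L)
    rwa [norm_pow, ← pow_add] at this

section Reach

variable {K : Type*} [NormedField K] [IsUltrametricDist K] {π : K} {P Q : ℕ}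
  {d m : ℕ} {ι : Type*} [Fintype ι] [DecidableEq ι] {a : ι → K} {n : ι → ℤ}

theorem not_reach_zero (h : IsModel π P Q) [ProperSpace K] (hd : d = 2 * m) (hm : Odd m)
    (ha : ∀ x : ι → K, ∑ i, a i * x i ^ d = 0 → x = 0) {L : ℕ} {S : List ι} :
    ¬ Reach π d a n L S 0 := by
  rintro ⟨j, hj, hj4, x, hx, ⟨i, hi⟩, hs⟩
  have hv : val π 0 = 0 := by simp [val]
  rw [hv, mul_zero, Near, sub_zero, pow_add] at hs
  obtain ⟨y, hy, hy0⟩ := h.exists_zero_of_near hd hm (h.pow_pos j) hi hs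
  exact hy (ha y hy0)

/-- Precision is always measured from the largest term, at level `j`, so both residues `y` with the
same product `π y` are legitimate quotients. A sum that survived up to `L = j + 4` and is again
divisible by `π` is small enough to be corrected to a zero. -/
theorem Reach.succ (h : IsModel π P Q) [ProperSpace K] (hd : d = 2 * m) (hm : Odd m)
    (ha : ∀ x : ι → K, ∑ i, a i * x i ^ d = 0 → x = 0) {L : ℕ} {S : List ι}
    (hS : ∀ i ∈ S, (d : ℤ) ∣ L - n i) {y : ℕ} (hr : Reach π d a n L S (mulCode P Q 8 y)) :
    Reach π d a n (L + 1) [] y := by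
  obtain ⟨j, hj, hj4, x, hx, hi, hs⟩ := hr
  have hv : val π 8 = π := by simp [val]
  have hs' : Near (‖π‖ ^ (j + 5)) (∑ i, a i * x i ^ d) (π ^ (L + 1) * val π y) := by
    refine hs.trans ?_
    have := ((h.near_mulCode 8 y).symm.mul_left (π ^ L)).mono (r' := ‖π‖ ^ (j + 5)) (by
      rw [norm_pow, ← pow_add]
      exact h.pow_le (by omega))
    rwa [hv, ← mul_assoc, ← pow_succ] at this
  rcases Nat.lt_or_ge L (j + 4) with hlt | hge
  · refine ⟨j, by omega, by omega, x, fun i hi' => .inr ?_, hi, hs'⟩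
    rcases hx i hi' with h1 | ⟨L', h1, h2, h3⟩
    · exact ⟨L, by omega, hj, hS i h1⟩
    · exact ⟨L', by omega, h2, h3⟩
  · exfalso
    obtain ⟨i, hi⟩ := hi
    have hsmall : ‖∑ i, a i * x i ^ d‖ ≤ ‖π‖ ^ j * ‖π‖ ^ 5 := by
      rw [← pow_add]
      refine hs'.norm_le ?_
      rw [norm_mul, norm_pow]
      exact (mul_le_of_le_one_right (h.pow_pos _).le (h.norm_val_le y)).trans (h.pow_le (by omega))
    obtain ⟨y, hy, hy0⟩ := h.exists_zero_of_near hd hm (h.pow_pos j) hi hsmall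
    exact hy (ha y hy0)

theorem Reach.of_extend (h : IsModel π P Q) (hd5 : 5 ≤ d) {u : ι → K}
    (hau : ∀ i, a i = π ^ n i * u i) (hu : ∀ i, ‖u i‖ = 1) {i : ι} {g : UnitClass}
    (hg : ∀ v, v = g.fst ∨ v = g.snd →
      ∃ w : K, ‖w‖ = 1 ∧ Near (‖π‖ ^ 5) (u i * w ^ d) (val π v))
    (hg1 : g.fst < 32) (hg2 : g.snd < 32) {L : ℕ} (hL : (d : ℤ) ∣ L - n i) {S : List ι}
    (hiS : i ∉ S) {U : ℕ}
    (hU : ∀ k < 32, U.testBit k = true → Reach π d a n L S k) :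
    ∀ k < 32, (extend g U).testBit k = true → Reach π d a n L (S ++ [i]) k := by
  intro k hk hbit
  rcases testBit_extend hg1 hg2 hk hbit with h1 | ⟨v, hv, h1⟩
  · exact (hU k hk h1).append i
  obtain ⟨w, hw, huw⟩ := hg v hv
  obtain ⟨y, hy, hyv⟩ := exists_term h (hau i) (hu i) hw huw hL
  have hd0 : d ≠ 0 := by omega
  rcases h1 with rfl | ⟨k', hk', hbit', rfl⟩
  · refine ⟨L, le_rfl, by omega, Pi.single i y, fun i' hi' => .inl ?_, ⟨i, ?_⟩, ?_⟩
    · by_contra hne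
      exact hi' (Pi.single_eq_of_ne (by rintro rfl; exact hne (by simp)) _)
    · rwa [Pi.single_eq_same]
    · rw [Finset.sum_eq_single i]
      · rwa [Pi.single_eq_same]
      · intro i' _ hne
        rw [Pi.single_eq_of_ne hne, zero_pow hd0, mul_zero]
      · simp
  · obtain ⟨j, hj, hj4, x, hx, ⟨i₀, hi₀⟩, hs⟩ := hU k' hk' hbit'
    -- The old sum uses levels at distance at most four below `L`, while the previous level of the
    -- variable `i` is `d ≥ 5` below. So the variable is free for the new term.
    have hxi : x i = 0 := by
      by_contra hne
      rcases hx i hne with h1 | ⟨L', h1, h2, h3⟩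
      · exact hiS h1
      · have h4 := dvd_sub hL h3
        rw [sub_sub_sub_cancel_right] at h4
        have h5 := Int.le_of_dvd (by omega) h4
        omega
    have hne : i₀ ≠ i := by
      rintro rfl
      rw [hxi, zero_pow hd0, mul_zero, norm_zero] at hi₀
      exact (h.pow_pos j).ne hi₀
    refine ⟨j, hj, hj4, Function.update x i y, fun i' hi' => ?_, ⟨i₀, ?_⟩, ?_⟩
    · by_cases hii : i' = i
      · subst hii
        exact .inl (by simp)
      · rw [Function.update_of_ne hii] at hi'
        rcases hx i' hi' with h1 | h1
        · exact .inl (by simp [h1])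
        · exact .inr h1
    · rwa [Function.update_of_ne hne]
    · have e1 := Finset.add_sum_erase Finset.univ
        (fun j => a j * Function.update x i y j ^ d) (Finset.mem_univ i)
      have e2 := Finset.add_sum_erase Finset.univ (fun j => a j * x j ^ d) (Finset.mem_univ i)
      have e3 : ∑ j ∈ Finset.univ.erase i, a j * Function.update x i y j ^ d =
          ∑ j ∈ Finset.univ.erase i, a j * x j ^ d := by
        refine Finset.sum_congr rfl fun j hj => ?_
        rw [Function.update_of_ne (Finset.ne_of_mem_erase hj)]
      simp only [Function.update_self] at e1
      simp only [hxi, zero_pow hd0, mul_zero, zero_add] at e2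
      rw [← e1, e3, e2, add_comm (a i * y ^ d)]
      refine (hs.add (hyv.mono (h.pow_le (by omega)))).trans ?_
      have := ((h.near_addCode k' v).mul_left (π ^ L)).mono (r' := ‖π‖ ^ (j + 5)) (by
        rw [norm_pow, ← pow_add]
        exact h.pow_le (by omega))
      rwa [mul_add] at this

end Reach

/-- The variables of level `L`, sorted by their classes. -/
noncomputable def levelList {ι : Type*} [Fintype ι] (d : ℕ) (n : ι → ℤ) (cl : ι → UnitClass)
    (gs : List UnitClass) (L : ℕ) : List ι := by
  classical
  exact gs.flatMap fun g => (Finset.univ.filter fun i => (d : ℤ) ∣ L - n i ∧ cl i = g).toList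

section levelList

variable {ι : Type*} [Fintype ι] {d : ℕ} {n : ι → ℤ} {cl : ι → UnitClass} {gs : List UnitClass}

theorem mem_levelList {L : ℕ} {i : ι} :
    i ∈ levelList d n cl gs L ↔ (d : ℤ) ∣ L - n i ∧ cl i ∈ gs := by
  classical
  simp only [levelList, List.mem_flatMap, Finset.mem_toList, Finset.mem_filter, Finset.mem_univ,
    true_and]
  constructor
  · rintro ⟨g, hg, h1, rfl⟩
    exact ⟨h1, hg⟩
  · rintro ⟨h1, h2⟩
    exact ⟨_, h2, h1, rfl⟩

theorem nodup_levelList (hgs : gs.Nodup) (L : ℕ) : (levelList d n cl gs L).Nodup := by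
  classical
  rw [levelList, List.nodup_flatMap]
  refine ⟨fun g _ => Finset.nodup_toList _, hgs.imp fun {g g'} hne => ?_⟩
  intro i h1 h2
  simp only [Finset.mem_toList, Finset.mem_filter] at h1 h2
  exact hne (h1.2.2.symm.trans h2.2.2)

theorem follows_map_levelList (L : ℕ) : Follows gs ((levelList d n cl gs L).map cl) := by
  classical
  have : (levelList d n cl gs L).map cl = gs.flatMap fun g =>
      List.replicate (Finset.univ.filter fun i => (d : ℤ) ∣ L - n i ∧ cl i = g).card g := by
    rw [levelList, List.map_flatMap]
    congr 1
    funext g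
    rw [List.eq_replicate_iff]
    refine ⟨by simp, fun b hb => ?_⟩
    simp only [List.mem_map, Finset.mem_toList, Finset.mem_filter] at hb
    obtain ⟨i, hi, rfl⟩ := hb
    exact hi.2.2
  rw [this]
  exact follows_flatMap _ _

theorem levelList_add_period (L : ℕ) : levelList d n cl gs (L + d) = levelList d n cl gs L := by
  classical
  rw [levelList, levelList]
  congr 1
  funext g
  congr 2
  ext i
  have : ((L + d : ℕ) : ℤ) - n i = (L - n i) + d := by push_cast; ring
  rw [this, dvd_add_self_right]

theorem sum_length_levelList (hgs : gs.Nodup) (hcl : ∀ i, cl i ∈ gs) (hd : 0 < d) :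
    ∑ L ∈ Finset.range d, (levelList d n cl gs L).length = Fintype.card ι := by
  classical
  have hlen : ∀ L ∈ Finset.range d, (levelList d n cl gs L).length =
      (Finset.univ.filter fun i => (n i % d).toNat = L).card := by
    intro L hL
    rw [← List.toFinset_card_of_nodup (nodup_levelList hgs L)]
    congr 1
    ext i
    rw [List.mem_toFinset, mem_levelList, Finset.mem_filter]
    have hL' := Finset.mem_range.mp hL
    have h1 := Int.emod_nonneg (n i) (b := d) (by omega)
    have h2 : (L : ℤ) % d = L := Int.emod_eq_of_lt (by omega) (by omega)
    have h3 : (d : ℤ) ∣ L - n i ↔ n i % d = L := by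
      rw [← Int.emod_emod_of_dvd _ dvd_rfl, ← Int.modEq_iff_dvd, Int.ModEq, h2]
      simp
    simp only [hcl i, and_true, Finset.mem_univ, true_and, h3]
    omega
  rw [Finset.sum_congr rfl hlen, ← Finset.card_univ]
  refine (Finset.card_eq_sum_card_fiberwise fun i _ => ?_).symm
  have h1 := Int.emod_nonneg (n i) (b := d) (by omega)
  have h2 := Int.emod_lt_of_pos (n i) (b := d) (by omega)
  simp only [Finset.coe_range, Set.mem_Iio]
  omega

end levelList

/-- An anisotropic form yields labels for the levels. -/
theorem exists_labels_of_anisotropic {K : Type*} [NormedField K] [IsUltrametricDist K]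
    [ProperSpace K] {π : K} {P Q : ℕ} (h : IsModel π P Q) {d m : ℕ} (hd : d = 2 * m) (hm : Odd m)
    (hm3 : 3 ≤ m) {gs : List UnitClass} {s : ℕ} (hs : s = mulCode P Q 9 9)
    (hss : mulCode P Q s s = 1)
    (hgs : ∀ t < 32, t % 2 = 1 → ∃ g ∈ gs, (g.fst = t ∧ g.snd = mulCode P Q t s) ∨
      (g.snd = t ∧ g.fst = mulCode P Q t s))
    (hlt : ∀ g ∈ gs, g.fst < 32 ∧ g.snd < 32) (hnd : gs.Nodup)
    {good : ℕ → ℕ → ℕ → ℕ → Bool} {T : List (ℕ × ℕ)} (hver : verify P Q gs good T = true)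
    {e₀ : ℕ} (hT : (0, e₀) ∈ T) {ι : Type*} [Fintype ι] {a : ι → K}
    (ha : ∀ x : ι → K, ∑ i, a i * x i ^ d = 0 → x = 0) :
    ∃ c t e : ℕ → ℕ, (∀ L, c (L + d) = c L) ∧ (∀ L, t (L + d) = t L) ∧
      ∑ L ∈ Finset.range d, c L = Fintype.card ι ∧
      ∀ L, good (c L) (t L) (e L) (e (L + 1)) = true := by
  classical
  have hd0 : d ≠ 0 := by omega
  have ha0 : ∀ i, a i ≠ 0 := by
    intro i hi
    have := congrFun (ha (Pi.single i 1) ?_) i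
    · simp at this
    · refine Finset.sum_eq_zero fun j _ => ?_
      by_cases hj : j = i
      · rw [hj, hi, zero_mul]
      · rw [Pi.single_eq_of_ne hj, zero_pow hd0, mul_zero]
  choose n hn using fun i => h.exists_zpow (a i) (ha0 i)
  set u : ι → K := fun i => a i / π ^ n i with hu_def
  have hau : ∀ i, a i = π ^ n i * u i := fun i => by
    rw [hu_def]
    exact (mul_div_cancel₀ _ (zpow_ne_zero _ h.ne_zero)).symm
  have hu : ∀ i, ‖u i‖ = 1 := fun i => by
    simp only [hu_def, norm_div, norm_zpow, hn i]
    exact div_self (zpow_pos h.norm_pos _).ne'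
  choose cl hcl hclv using fun i => h.exists_class hs hss hgs hd hm (hu i)
  set lst := levelList d n cl gs with hlst
  -- The two invariants that follow say that every bit of a mask is backed by an actual sum of
  -- terms. The induction runs over the variables admitted at one level, and then over the levels.
  set w : ℕ → List UnitClass := fun L => (lst L).map cl with hw
  have inv : ∀ L, (∀ k < 32, (state P Q w L).testBit k = true → Reach π d a n L [] k) →
      ∀ l, l <+: lst L → ∀ k < 32, (extendList (l.map cl) (state P Q w L)).testBit k = true →
        Reach π d a n L l k := by
    intro L hL l
    induction l using List.reverseRecOn with
    | nil => intro _; simpa [extendList] using hL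
    | append_singleton l i ih =>
      intro hpre
      have hpre' : l <+: lst L := (List.prefix_append l [i]).trans hpre
      have hi : i ∈ lst L := hpre.subset (by simp)
      have hnodup : (l ++ [i]).Nodup := hpre.sublist.nodup (nodup_levelList hnd L)
      have hil : i ∉ l := by
        intro hmem
        exact (List.nodup_append.mp hnodup).2.2 i hmem i (by simp) rfl
      rw [List.map_append, List.map_singleton, extendList, List.foldl_append]
      exact Reach.of_extend h (by omega) hau hu (hclv i) (hlt _ (hcl i)).1 (hlt _ (hcl i)).2
        (mem_levelList.mp hi).1 hil (ih hpre')
  have inv' : ∀ L, ∀ k < 32, (state P Q w L).testBit k = true → Reach π d a n L [] k := by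
    intro L
    induction L with
    | zero => intro k _ hk; simp [state] at hk
    | succ L ih =>
      intro k hk hbit
      rw [state] at hbit
      obtain ⟨-, hbit'⟩ := testBit_divPi hbit
      refine Reach.succ h hd hm ha (S := lst L) (fun i hi => (mem_levelList.mp hi).1) ?_
      refine inv L ih (lst L) (List.prefix_refl _) _ ?_ hbit'
      rw [mulCode]
      omega
  have nozero : ∀ L p, p <+: w L → (extendList p (state P Q w L)).testBit 0 = false := by
    intro L p hp
    rw [← Bool.not_eq_true]
    intro hbit
    obtain ⟨l, hl, rfl⟩ : ∃ l, l <+: lst L ∧ p = l.map cl := by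
      have := List.prefix_iff_eq_take.mp hp
      exact ⟨(lst L).take p.length, List.take_prefix _ _, by rw [List.map_take]; exact this⟩
    exact not_reach_zero h hd hm ha (inv L (inv' L) l hl 0 (by norm_num) hbit)
  obtain ⟨e, he⟩ := exists_labels hver hT (fun L => follows_map_levelList L) nozero
  refine ⟨fun L => (w L).length, fun L => (w L).countP (·.odd), e, fun L => ?_, fun L => ?_, ?_, he⟩
  · simp only [hw, hlst, levelList_add_period]
  · simp only [hw, hlst, levelList_add_period]
  · simp only [hw, List.length_map]
    exact sum_length_levelList hnd hcl (by omega)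

/-! ### Upper bounds -/

theorem guaranteesZero_of_not_anisotropic {K : Type*} [Field K] {d s : ℕ}
    (h : ∀ a : Fin s → K, ¬ ∀ x : Fin s → K, ∑ i, a i * x i ^ d = 0 → x = 0) :
    GuaranteesZero d s K := by
  intro a
  have := h a
  push Not at this
  obtain ⟨x, h1, h2⟩ := this
  exact ⟨x, h2, h1⟩

section upper

variable {K : Type*} [NormedField K] [IsUltrametricDist K] [ProperSpace K] {π : K} {d m : ℕ}

theorem guaranteesZero_three_halves (h : IsModel π 2 0) (hd : d = 2 * m) (hm : Odd m)
    (hm3 : 3 ≤ m) : GuaranteesZero d (3 * m) K := by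
  refine guaranteesZero_of_not_anisotropic fun a ha => ?_
  obtain ⟨c, t, e, hc, ht, hs, hg⟩ := exists_labels_of_anisotropic h hd hm hm3
    (gs := classes 2 0 repsTwoZero) rfl (by decide) (by decide +kernel) (by decide +kernel)
    (by decide +kernel) verify_two_zero (e₀ := 256) (by decide +kernel) ha
  rw [Fintype.card_fin] at hs
  exact not_goodThreeHalves hd hm hm3 hc ht hs hg

theorem guaranteesZero_succ_of_six_two (h : IsModel π 6 2) (hd : d = 2 * m) (hm : Odd m)
    (hm3 : 3 ≤ m) : GuaranteesZero d (d + 1) K := by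
  refine guaranteesZero_of_not_anisotropic fun a ha => ?_
  obtain ⟨c, t, e, hc, ht, hs, hg⟩ := exists_labels_of_anisotropic h hd hm hm3
    (gs := classes 6 2 repsSixTwo) rfl (by decide) (by decide +kernel) (by decide +kernel)
    (by decide +kernel) verify_six_two (e₀ := 3) (by decide +kernel) ha
  rw [Fintype.card_fin] at hs
  exact not_goodUnit hc hs hg

theorem guaranteesZero_succ_of_two_two (h : IsModel π 2 2) (hd : d = 2 * m) (hm : Odd m)
    (hm3 : 3 ≤ m) : GuaranteesZero d (d + 1) K := by
  refine guaranteesZero_of_not_anisotropic fun a ha => ?_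
  obtain ⟨c, t, e, hc, ht, hs, hg⟩ := exists_labels_of_anisotropic h hd hm hm3
    (gs := classes 2 2 repsTwoTwo) rfl (by decide) (by decide +kernel) (by decide +kernel)
    (by decide +kernel) verify_two_two (e₀ := 4) (by decide +kernel) ha
  rw [Fintype.card_fin] at hs
  exact not_goodUnit hc hs hg

end upper

/-! ### Lower bounds by anisotropic forms -/

theorem not_guaranteesZero {K ι : Type*} [Field K] [Fintype ι] {d s : ℕ} (hd : d ≠ 0)
    (hs : s ≤ Fintype.card ι) {a : ι → K} (ha : ∀ x : ι → K, ∑ i, a i * x i ^ d = 0 → x = 0) :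
    ¬ GuaranteesZero d s K := by
  intro hG
  obtain ⟨f⟩ := Function.Embedding.nonempty_of_card_le (α := Fin s) (β := ι) (by simpa using hs)
  obtain ⟨x, hx, hsum⟩ := hG (a ∘ f)
  apply hx
  have h0 := ha (Function.extend f x 0) ?_
  · ext i
    have := congrFun h0 (f i)
    rwa [f.injective.extend_apply] at this
  · rw [← hsum]
    refine (Fintype.sum_of_injective f f.injective _ _ (fun i hi => ?_) fun i => ?_).symm
    · rw [Function.extend_apply' _ _ _ (by simpa using hi), Pi.zero_apply, zero_pow hd, mul_zero]
    · rw [f.injective.extend_apply, Function.comp_apply]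

theorem isLeast_of_not_guaranteesZero {K ι : Type*} [Field K] [Fintype ι] {d s : ℕ} (hd : d ≠ 0)
    (hs : s ≤ Fintype.card ι + 1) (hG : GuaranteesZero d s K) {a : ι → K}
    (ha : ∀ x : ι → K, ∑ i, a i * x i ^ d = 0 → x = 0) : GammaStarEq d K s := by
  refine ⟨hG, fun s' hs' => ?_⟩
  by_contra hlt
  exact not_guaranteesZero hd (by omega) ha hs'

theorem sum_ne_zero_of_unique_norm {K ι : Type*} [NormedField K] [IsUltrametricDist K] [Fintype ι]
    {f : ι → K} {i : ι} (hi : f i ≠ 0) (hf : ∀ j ≠ i, ‖f j‖ < ‖f i‖) : ∑ j, f j ≠ 0 := by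
  classical
  intro h0
  have hlt : ‖∑ j ∈ Finset.univ.erase i, f j‖ < ‖f i‖ :=
    Finset.sum_induction f (fun y => ‖y‖ < ‖f i‖)
      (fun x y hx hy => (IsUltrametricDist.norm_add_le_max x y).trans_lt (max_lt hx hy))
      (by simpa using hi) fun j hj => hf j (Finset.ne_of_mem_erase hj)
  rw [← Finset.add_sum_erase _ _ (Finset.mem_univ i), add_eq_zero_iff_eq_neg] at h0
  rw [h0, norm_neg] at hlt
  exact lt_irrefl _ hlt

theorem Int.eq_zero_of_mul_eq {m k x : ℤ} (h : m * k = x) (h1 : -m < x) (h2 : x < m) : k = 0 := by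
  have hm : 0 < m := by omega
  rcases lt_trichotomy k 0 with hk | hk | hk
  · nlinarith
  · exact hk
  · nlinarith

theorem norm_natCast_of_odd {K : Type*} [NormedField K] [IsUltrametricDist K] {n : ℕ} (hn : Odd n)
    (h2 : ‖(2 : K)‖ < 1) : ‖(n : K)‖ = 1 := by
  obtain ⟨k, rfl⟩ := hn
  have : Near ‖(2 : K)‖ ((2 * k + 1 : ℕ) : K) 1 := by
    rw [Near]
    push_cast
    rw [add_sub_cancel_right, norm_mul]
    exact mul_le_of_le_one_right (norm_nonneg _) (IsUltrametricDist.norm_natCast_le_one K k)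
  rw [this.norm_eq (by simpa using h2), norm_one]

namespace IsModel

variable {K : Type*} [NormedField K] {π : K} {P Q : ℕ}

theorem norm_term (h : IsModel π P Q) {d : ℕ} {b x : K} {r : ℕ} (hb : ‖b‖ = ‖π‖ ^ r) {e : ℤ}
    (hx : ‖x‖ = ‖π‖ ^ e) : ‖b * x ^ d‖ = ‖π‖ ^ ((r : ℤ) + d * e) := by
  have hπ : ‖π‖ ≠ 0 := h.norm_pos.ne'
  rw [norm_mul, norm_pow, hb, hx, zpow_add₀ hπ, zpow_natCast, mul_comm (d : ℤ), zpow_mul,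
    zpow_natCast]

theorem zpow_inj (h : IsModel π P Q) {m n : ℤ} (hmn : ‖π‖ ^ m = ‖π‖ ^ n) : m = n :=
  zpow_right_injective₀ h.norm_pos h.norm_lt_one.ne hmn

theorem near_two (h : IsModel π 2 0) : Near (‖π‖ ^ 5) 2 (π ^ 2) := by simpa using h.sq.symm

variable [IsUltrametricDist K]

/-- The form `∑ π ^ j x_j ^ d` with `j < d` is anisotropic. -/
theorem anisotropic_powers (h : IsModel π P Q) {d : ℕ} (hd : d ≠ 0) (x : Fin d → K)
    (hx : ∑ j : Fin d, π ^ (j : ℕ) * x j ^ d = 0) : x = 0 := by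
  by_contra hne
  obtain ⟨j₀, hj₀⟩ := Function.ne_iff.mp hne
  rw [Pi.zero_apply] at hj₀
  obtain ⟨i, -, hi⟩ := Finset.exists_max_image Finset.univ
    (fun j : Fin d => ‖π ^ (j : ℕ) * x j ^ d‖) ⟨j₀, Finset.mem_univ _⟩
  have hne0 : ∀ j, x j ≠ 0 → π ^ (j : ℕ) * x j ^ d ≠ 0 := fun j hj =>
    mul_ne_zero (pow_ne_zero _ h.ne_zero) (pow_ne_zero _ hj)
  have hpos : 0 < ‖π ^ (i : ℕ) * x i ^ d‖ :=
    lt_of_lt_of_le (norm_pos_iff.mpr (hne0 j₀ hj₀)) (hi j₀ (Finset.mem_univ _))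
  have hxi : x i ≠ 0 := by
    intro h0
    rw [h0, zero_pow hd, mul_zero, norm_zero] at hpos
    exact lt_irrefl _ hpos
  refine sum_ne_zero_of_unique_norm (f := fun j : Fin d => π ^ (j : ℕ) * x j ^ d) (i := i)
    (hne0 i hxi) (fun j hj => ?_) hx
  refine lt_of_le_of_ne (hi j (Finset.mem_univ _)) fun heq => hj ?_
  by_cases hxj : x j = 0
  · rw [hxj, zero_pow hd, mul_zero, norm_zero] at heq
    exact absurd heq hpos.ne
  · obtain ⟨e, he⟩ := h.exists_zpow _ hxi
    obtain ⟨e', he'⟩ := h.exists_zpow _ hxj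
    rw [h.norm_term (norm_pow _ _) he, h.norm_term (norm_pow _ _) he'] at heq
    have h1 := h.zpow_inj heq
    have hi' := i.isLt
    have hj' := j.isLt
    -- Equal norms force `d ∣ j - i`, whereas both indices lie in `[0, d)`.
    have h2 : (d : ℤ) * (e - e') = (j : ℤ) - i := by rw [mul_sub]; linarith
    have h3 := Int.eq_zero_of_mul_eq h2 (by omega) (by omega)
    rw [h3, mul_zero] at h2
    exact Fin.ext (by omega)

section lower

variable (h : IsModel π 2 0)

include h

/-- A unit square has code 1 or 19 modulo `π⁵`, and the odd power `m` fixes both. Code 19 is `3 + 2π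
≡ 1 + θ`, since `π² ≡ 2`. -/
theorem near_unit_pow {d m : ℕ} (hd : d = 2 * m) (hm : Odd m) {w : K} (hw : ‖w‖ = 1) :
    ∃ ε : ℕ, Near (‖π‖ ^ 4) (w ^ d) (1 + π ^ 2 * (1 + π) * ε) := by
  obtain ⟨c, hc, hwc⟩ := h.exists_near_val hw.le
  have hr : (0 : ℝ) ≤ ‖π‖ ^ 5 := (h.pow_pos _).le
  have hodd : c % 2 = 1 := by
    by_contra hne
    have h1 := h.norm_val_lt_one (c := c) (by omega)
    have h2 := hwc.symm.norm_eq (by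
      rw [hw]
      exact pow_lt_one₀ h.norm_pos.le h.norm_lt_one (by norm_num))
    rw [h2, hw] at h1
    exact lt_irrefl _ h1
  have hval1 : val π 1 = 1 := by norm_num [val]
  have hval19 : val π 19 = 3 + 2 * π := by norm_num [val]
  have hsq : Near (‖π‖ ^ 5) (w ^ 2) (val π (mulCode 2 0 c c)) := by
    rw [pow_two w]
    exact (hwc.mul hwc hw.le (h.norm_val_le c)).trans (h.near_mulCode c c)
  have hcases : ∀ c < 32, c % 2 = 1 → (mulCode 2 0 c c = 1 ∨ mulCode 2 0 c c = 19) ∧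
      mulCode 2 0 (mulCode 2 0 c c) (mulCode 2 0 c c) = 1 := by decide +kernel
  obtain ⟨hc1, hc2⟩ := hcases c hc hodd
  have hfour : Near (‖π‖ ^ 5) ((w ^ 2) ^ 2) 1 := by
    rw [pow_two (w ^ 2)]
    have := h.near_mulCode (mulCode 2 0 c c) (mulCode 2 0 c c)
    rw [hc2, hval1] at this
    exact (hsq.mul hsq (by rw [norm_pow, hw, one_pow]) (h.norm_val_le _)).trans this
  have hpow : Near (‖π‖ ^ 5) (w ^ d) (val π (mulCode 2 0 c c)) := by
    obtain ⟨k, rfl⟩ := hm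
    rw [hd, pow_mul, pow_succ _ (2 * k), pow_mul (w ^ 2) 2 k, ← one_mul (val π _)]
    refine (hfour.pow_one hr ?_ k).mul hsq ?_ (h.norm_val_le _)
    · rw [norm_pow, norm_pow, hw, one_pow, one_pow]
    · rw [norm_pow, norm_pow, norm_pow, hw, one_pow, one_pow, one_pow]
  replace hpow := hpow.mono (h.pow_le (show 4 ≤ 5 by norm_num))
  rcases hc1 with h1 | h1
  · exact ⟨0, by rwa [h1, hval1, ← add_zero (1 : K), ← mul_zero (π ^ 2 * (1 + π)),
      ← Nat.cast_zero] at hpow⟩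
  · refine ⟨1, hpow.trans ?_⟩
    rw [h1, hval19, Near, Nat.cast_one, mul_one,
      show 3 + 2 * π - (1 + π ^ 2 * (1 + π)) = (2 - π ^ 2) * (1 + π) by ring, norm_mul]
    refine (mul_le_of_le_one_right (norm_nonneg _) ?_).trans
      ((show ‖2 - π ^ 2‖ ≤ ‖π‖ ^ 5 from h.near_two).trans (h.pow_le (by norm_num)))
    exact (IsUltrametricDist.norm_add_le_max _ _).trans (max_le (by simp) h.norm_lt_one.le)

theorem norm_one_add : ‖1 + π‖ = 1 := by
  have : Near ‖π‖ (1 + π) 1 := by rw [Near, add_sub_cancel_left]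
  rw [this.norm_eq (by simpa using h.norm_lt_one), norm_one]

theorem norm_theta : ‖π ^ 2 * (1 + π)‖ = ‖π‖ ^ 2 := by
  rw [norm_mul, norm_pow, h.norm_one_add, mul_one]

/-- Modulo `π⁴` one has `2θ ≡ 0`, so only the parity of `N` counts: the value is `2`, or `2 + θ ≡
2π² + π³ ≡ π³`. Neither vanishes. -/
theorem not_near_zero (N : ℕ) : ¬ Near (‖π‖ ^ 4) (2 + π ^ 2 * (1 + π) * N) 0 := by
  intro h0
  rw [Near, sub_zero] at h0
  have hN : ∀ M : ℕ, ‖π ^ 2 * (1 + π) * (2 * (M : K))‖ ≤ ‖π‖ ^ 4 := by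
    intro M
    rw [norm_mul (π ^ 2 * (1 + π)), h.norm_theta, norm_mul, h.norm_two, ← mul_assoc, ← pow_add]
    exact mul_le_of_le_one_right (h.pow_pos _).le (IsUltrametricDist.norm_natCast_le_one K M)
  rcases Nat.even_or_odd' N with ⟨M, rfl | rfl⟩
  · have : Near (‖π‖ ^ 4) 2 (2 + π ^ 2 * (1 + π) * ((2 * M : ℕ) : K)) := by
      rw [Near, sub_add_cancel_left, norm_neg]
      push_cast
      exact hN M
    have := this.norm_le h0
    rw [h.norm_two] at this
    exact absurd this (not_le.mpr (h.pow_lt (by norm_num)))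
  · have h1 : Near (‖π‖ ^ 4) (π ^ 3) (2 + π ^ 2 * (1 + π) * ((2 * M + 1 : ℕ) : K)) := by
      rw [Near, show π ^ 3 - (2 + π ^ 2 * (1 + π) * ((2 * M + 1 : ℕ) : K)) =
        -(π ^ 2 * (1 + π) * (2 * (M : K))) + (-(2 - π ^ 2) + -(2 * π ^ 2)) by push_cast; ring]
      refine (IsUltrametricDist.norm_add_le_max _ _).trans (max_le ?_
        ((IsUltrametricDist.norm_add_le_max _ _).trans (max_le ?_ ?_)))
      · rw [norm_neg]
        exact hN M
      · rw [norm_neg]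
        exact (show ‖2 - π ^ 2‖ ≤ ‖π‖ ^ 5 from h.near_two).trans (h.pow_le (by norm_num))
      · rw [norm_neg, norm_mul, norm_pow, h.norm_two, ← pow_add]
    have := h1.norm_le h0
    rw [norm_pow] at this
    exact absurd this (not_le.mpr (h.pow_lt (by norm_num)))

/-- The form consisting of `π x ^ d` and of terms `θ ^ (J i) x_i ^ d`, where `θ = π² (1 + π)`, is
anisotropic if there are at most three terms for each exponent, and at most one for `m - 1`. -/
theorem anisotropic_theta {d m : ℕ} (hd : d = 2 * m) (hm : Odd m) {ι : Type*} [Fintype ι]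
    {J : ι → ℕ} (hJ : ∀ i, J i < m)
    (hJ3 : ∀ j, (Finset.univ.filter fun i => J i = j).card ≤ 3)
    (hJ1 : (Finset.univ.filter fun i => J i + 1 = m).card ≤ 1) (x : Option ι → K)
    (hx : ∑ o, (o.elim π fun i => (π ^ 2 * (1 + π)) ^ J i) * x o ^ d = 0) : x = 0 := by
  classical
  set θ := π ^ 2 * (1 + π) with hθ
  set a : Option ι → K := fun o => o.elim π fun i => θ ^ J i with ha
  have hθn : ‖θ‖ = ‖π‖ ^ 2 := h.norm_theta
  have hπ0 := h.ne_zero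
  have hθ0 : θ ≠ 0 := by
    rw [← norm_pos_iff, hθn]
    exact h.pow_pos 2
  have ha0 : ∀ o, a o ≠ 0 := by
    intro o
    cases o with
    | none => exact hπ0
    | some i => exact pow_ne_zero _ hθ0
  have hd0 : d ≠ 0 := by
    obtain ⟨k, rfl⟩ := hm
    omega
  by_contra hne
  obtain ⟨o₁, ho₁⟩ := Function.ne_iff.mp hne
  rw [Pi.zero_apply] at ho₁
  obtain ⟨o₀, -, ho₀⟩ := Finset.exists_max_image Finset.univ
    (fun o => ‖a o * x o ^ d‖) ⟨o₁, Finset.mem_univ _⟩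
  have hpos : 0 < ‖a o₀ * x o₀ ^ d‖ :=
    lt_of_lt_of_le (norm_pos_iff.mpr (mul_ne_zero (ha0 o₁) (pow_ne_zero _ ho₁)))
      (ho₀ o₁ (Finset.mem_univ _))
  have hxo₀ : x o₀ ≠ 0 := by
    intro h0
    rw [h0, zero_pow hd0, mul_zero, norm_zero] at hpos
    exact lt_irrefl _ hpos
  have hsome : ∀ i, ‖a (some i)‖ = ‖π‖ ^ (2 * J i) := fun i => by
    rw [show a (some i) = θ ^ J i from rfl, norm_pow, hθn, pow_mul]
  have hnone : ‖a none‖ = ‖π‖ ^ 1 := by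
    rw [show a none = π from rfl, _root_.pow_one]
  cases o₀ with
  | none =>
    -- The term with coefficient `π` has odd valuation and all others have even valuation, so it
    -- cannot tie with them.
    refine sum_ne_zero_of_unique_norm (f := fun o => a o * x o ^ d) (i := none)
      (norm_pos_iff.mp hpos) (fun o ho => ?_) hx
    refine lt_of_le_of_ne (ho₀ o (Finset.mem_univ _)) fun heq => ?_
    cases o with
    | none => exact ho rfl
    | some i =>
      have hxi : x (some i) ≠ 0 := by
        intro h0
        simp only [h0, zero_pow hd0, mul_zero, norm_zero] at heq
        exact hpos.ne heq
      obtain ⟨e, he⟩ := h.exists_zpow _ hxo₀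
      obtain ⟨e', he'⟩ := h.exists_zpow _ hxi
      have heq' : ‖a (some i) * x (some i) ^ d‖ = ‖a none * x none ^ d‖ := heq
      rw [h.norm_term (hsome i) he', h.norm_term hnone he] at heq'
      have h1 := h.zpow_inj heq'
      subst hd
      push_cast at h1
      have h2 : 2 * ((J i : ℤ) + m * e' - m * e) = 1 := by linarith
      omega
  | some i₀ =>
    obtain ⟨e, he⟩ := h.exists_zpow _ hxo₀
    set j := J i₀ with hj
    -- Dividing by `c` makes the largest norm 1 and turns the terms of maximal norm into `d`-th
    -- powers of units.
    set c := a (some i₀) * (π ^ e) ^ d with hc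
    have hc0 : c ≠ 0 := mul_ne_zero (ha0 _) (pow_ne_zero _ (zpow_ne_zero _ hπ0))
    have hcn : ‖c‖ = ‖π‖ ^ ((2 * j : ℕ) + d * e : ℤ) := h.norm_term (hsome i₀) (norm_zpow _ _)
    have hcmax : ‖c‖ = ‖a (some i₀) * x (some i₀) ^ d‖ := by
      rw [hcn, h.norm_term (hsome i₀) he]
    set t : Option ι → K := fun o => a o * x o ^ d / c with ht
    have ht0 : ∑ o, t o = 0 := by
      rw [ht, ← Finset.sum_div, hx, zero_div]
    have ht1 : ∀ o, ‖t o‖ ≤ 1 := fun o => by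
      rw [ht, norm_div, hcmax]
      exact div_le_one_of_le₀ (ho₀ o (Finset.mem_univ _)) (norm_nonneg _)
    -- the exponents of the terms relative to the maximal one
    have texp_some : ∀ i, t (some i) = 0 ∨ ∃ k : ℤ, ‖x (some i)‖ = ‖π‖ ^ (e + k) ∧
        ‖t (some i)‖ = ‖π‖ ^ (2 * ((J i : ℤ) - j + m * k)) ∧ 0 ≤ (J i : ℤ) - j + m * k := by
      intro i
      by_cases hxi : x (some i) = 0
      · left
        simp only [ht, hxi, zero_pow hd0, mul_zero, zero_div]
      · right
        obtain ⟨e', he'⟩ := h.exists_zpow _ hxi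
        have hn : ‖t (some i)‖ = ‖π‖ ^ (2 * ((J i : ℤ) - j + m * (e' - e))) := by
          simp only [ht, norm_div]
          rw [h.norm_term (hsome i) he', hcn, ← zpow_sub₀ h.norm_pos.ne']
          congr 1
          rw [hd]
          push_cast
          ring
        refine ⟨e' - e, by rw [he']; congr 1; ring, hn, ?_⟩
        have h1 := ht1 (some i)
        rw [hn, ← zpow_zero ‖π‖, h.zpow_le_iff] at h1
        omega
    have texp_none : t none = 0 ∨ ∃ k : ℤ,
        ‖t none‖ = ‖π‖ ^ (1 - 2 * (j + m * k) : ℤ) ∧ 0 ≤ 1 - 2 * (j + m * k : ℤ) := by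
      by_cases hxn : x none = 0
      · left
        simp only [ht, hxn, zero_pow hd0, mul_zero, zero_div]
      · right
        obtain ⟨e', he'⟩ := h.exists_zpow _ hxn
        have hn : ‖t none‖ = ‖π‖ ^ (1 - 2 * (j + m * (e - e')) : ℤ) := by
          simp only [ht, norm_div]
          rw [h.norm_term hnone he', hcn, ← zpow_sub₀ h.norm_pos.ne']
          congr 1
          rw [hd]
          push_cast
          ring
        refine ⟨e - e', hn, ?_⟩
        have h1 := ht1 none
        rwa [hn, ← zpow_zero ‖π‖, h.zpow_le_iff] at h1
    have hjm : j < m := hJ i₀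
    -- terms of maximal norm
    set A := Finset.univ.filter fun i => ‖t (some i)‖ = 1 with hA
    have hi₀A : i₀ ∈ A := by
      rw [hA, Finset.mem_filter]
      refine ⟨Finset.mem_univ _, ?_⟩
      simp only [ht, norm_div]
      rw [hcmax, div_self hpos.ne']
    have tA : ∀ i ∈ A, J i = j ∧ ∃ ε : ℕ, Near (‖π‖ ^ 4) (t (some i)) (1 + θ * ε) := by
      intro i hi
      rw [hA, Finset.mem_filter] at hi
      rcases texp_some i with h0 | ⟨k, hk, hk1, hk0⟩
      · rw [h0, norm_zero] at hi
        exact absurd hi.2 (by norm_num)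
      · rw [hk1, ← zpow_zero ‖π‖] at hi
        have h1 := h.zpow_inj hi.2
        have hJi := hJ i
        have h2 : (m : ℤ) * k = j - J i := by omega
        have h3 := Int.eq_zero_of_mul_eq h2 (by omega) (by omega)
        have hJj : J i = j := by
          rw [h3, mul_zero] at h2
          omega
        refine ⟨hJj, ?_⟩
        have hw : ‖x (some i) / π ^ e‖ = 1 := by
          rw [norm_div, hk, h3, add_zero, norm_zpow, div_self (zpow_pos h.norm_pos _).ne']
        obtain ⟨ε, hε⟩ := h.near_unit_pow hd hm hw
        refine ⟨ε, ?_⟩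
        convert hε using 1
        simp only [ht, hc]
        rw [show a (some i) = a (some i₀) by
          change θ ^ J i = θ ^ J i₀
          rw [hJj], div_pow]
        exact mul_div_mul_left _ _ (ha0 _)
    have hAj : A ⊆ Finset.univ.filter fun i => J i = j := by
      intro i hi
      rw [Finset.mem_filter]
      exact ⟨Finset.mem_univ _, (tA i hi).1⟩
    have hA3 : A.card ≤ 3 := (Finset.card_le_card hAj).trans (hJ3 j)
    have hA1 : 0 < A.card := Finset.card_pos.mpr ⟨i₀, hi₀A⟩
    have h2lt : ‖(2 : K)‖ < 1 := by
      rw [h.norm_two]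
      exact pow_lt_one₀ h.norm_pos.le h.norm_lt_one (by norm_num)
    have hlt_some : ∀ i, i ∉ A → ‖t (some i)‖ < 1 := by
      intro i hi
      refine lt_of_le_of_ne (ht1 _) fun h1 => hi ?_
      rw [hA, Finset.mem_filter]
      exact ⟨Finset.mem_univ _, h1⟩
    have hlt_none : ‖t none‖ < 1 := by
      rcases texp_none with h0 | ⟨k, hk, hk0⟩
      · rw [h0, norm_zero]
        exact one_pos
      · rw [hk, ← zpow_zero ‖π‖, h.zpow_lt_iff]
        omega
    rw [Fintype.sum_option] at ht0
    have hq0 : (0 : ℝ) ≤ ‖π‖ := h.norm_pos.le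
    have sum_ite : ∀ f g : ι → K, (∑ i, if i ∈ A then f i else g i) =
        ∑ i ∈ A, f i + ∑ i ∈ Finset.univ.filter (fun i => i ∉ A), g i := by
      intro f g
      rw [Finset.sum_ite]
      congr 2
      ext i
      simp
    -- An odd number of units, each congruent to 1 modulo `π`, has a unit as sum. Since at most
    -- three terms are maximal, only a pair remains to be excluded.
    by_cases hodd : Odd A.card
    · have hs : Near ‖π‖ (t none + ∑ i, t (some i))
          (0 + ∑ i, if i ∈ A then (1 : K) else 0) := by
        refine Near.add (by simpa [Near] using h.norm_le_of_lt_one hlt_none)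
          (Near.sum hq0 fun i _ => ?_)
        split_ifs with hi
        · rw [hA, Finset.mem_filter] at hi
          exact h.near_one hi.2
        · simpa [Near] using h.norm_le_of_lt_one (hlt_some i hi)
      rw [ht0, sum_ite] at hs
      simp only [Finset.sum_const, nsmul_eq_mul, mul_one, mul_zero, add_zero,
        zero_add] at hs
      have h1 := hs.symm.norm_le (by simp)
      rw [norm_natCast_of_odd hodd h2lt] at h1
      exact absurd h1 (not_le.mpr h.norm_lt_one)
    · have hA2 : A.card = 2 := by
        rw [Nat.not_odd_iff_even] at hodd
        obtain ⟨k, hk⟩ := hodd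
        omega
      -- The single term with exponent `m - 1` cannot form a pair. So the next exponent is `j + 1`,
      -- without a wrap-around from `θ ^ m` to `π ^ d`.
      have hjm1 : j + 1 < m := by
        by_contra hge
        have : A ⊆ Finset.univ.filter fun i => J i + 1 = m := by
          intro i hi
          rw [Finset.mem_filter]
          exact ⟨Finset.mem_univ _, by rw [(tA i hi).1]; omega⟩
        have := (Finset.card_le_card this).trans hJ1
        omega
      -- Terms with the next exponent are `θ` times a unit power congruent to 1 modulo `π²`, hence
      -- `θ` modulo `π⁴`; all later ones vanish modulo `π⁴`.
      have tB : ∀ i, i ∉ A → ∃ N : ℕ, Near (‖π‖ ^ 4) (t (some i)) (θ * N) := by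
        intro i hi
        have hlt := hlt_some i hi
        rcases texp_some i with h0 | ⟨k, hk, hk1, hk0⟩
        · exact ⟨0, by simp [h0, Near]⟩
        · have hpos' : 0 < (J i : ℤ) - j + m * k := by
            rw [hk1, ← zpow_zero ‖π‖, h.zpow_lt_iff] at hlt
            omega
          rcases eq_or_lt_of_le (Int.add_one_le_iff.mpr hpos') with h1 | h1
          · have hJi := hJ i
            have h2 : (m : ℤ) * k = j + 1 - J i := by omega
            have h3 := Int.eq_zero_of_mul_eq h2 (by omega) (by omega)
            have hJj : J i = j + 1 := by
              rw [h3, mul_zero] at h2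
              omega
            have hw : ‖x (some i) / π ^ e‖ = 1 := by
              rw [norm_div, hk, h3, add_zero, norm_zpow, div_self (zpow_pos h.norm_pos _).ne']
            obtain ⟨ε, hε⟩ := h.near_unit_pow hd hm hw
            refine ⟨1, ?_⟩
            have e1 : t (some i) = θ * (x (some i) / π ^ e) ^ d := by
              simp only [ht, hc]
              rw [show a (some i) = θ * a (some i₀) by
                change θ ^ J i = θ * θ ^ J i₀
                rw [hJj, pow_succ'], div_pow, mul_assoc]
              rw [mul_div_assoc, mul_div_mul_left _ _ (ha0 _)]
            rw [e1]
            have hε' : Near (‖π‖ ^ 2) ((x (some i) / π ^ e) ^ d) 1 := by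
              refine (hε.mono (h.pow_le (by norm_num))).trans ?_
              rw [Near, add_sub_cancel_left, norm_mul, hθn]
              exact mul_le_of_le_one_right (h.pow_pos _).le
                (IsUltrametricDist.norm_natCast_le_one K ε)
            have := hε'.mul_left θ
            rwa [hθn, ← pow_add, ← Nat.cast_one] at this
          · refine ⟨0, ?_⟩
            rw [Nat.cast_zero, mul_zero, Near, sub_zero, hk1, ← zpow_natCast, h.zpow_le_iff]
            push_cast
            omega
      choose! ε hε using fun i hi => (tA i hi).2
      choose! N hN using tB
      have hs : Near (‖π‖ ^ 4) (∑ i, t (some i))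
          (∑ i, if i ∈ A then 1 + θ * (ε i : K) else θ * (N i : K)) := by
        refine Near.sum (h.pow_pos _).le fun i _ => ?_
        split_ifs with hi
        · exact hε i hi
        · exact hN i hi
      have hsum : (∑ i, if i ∈ A then 1 + θ * (ε i : K) else θ * (N i : K)) =
          2 + θ * ((∑ i ∈ A, ε i + ∑ i ∈ Finset.univ.filter (fun i => i ∉ A), N i : ℕ) : K) := by
        rw [sum_ite, Finset.sum_add_distrib, ← Finset.mul_sum, ← Finset.mul_sum]
        simp only [Finset.sum_const, hA2, nsmul_eq_mul, mul_one]
        push_cast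
        ring
      rw [hsum] at hs
      set M := ∑ i ∈ A, ε i + ∑ i ∈ Finset.univ.filter (fun i => i ∉ A), N i
      have hle : ‖∑ i, t (some i)‖ ≤ ‖π‖ ^ 2 := by
        refine (hs.mono (h.pow_le (by norm_num))).norm_le ?_
        refine (IsUltrametricDist.norm_add_le_max _ _).trans (max_le h.norm_two.le ?_)
        rw [norm_mul, hθn]
        exact mul_le_of_le_one_right (h.pow_pos _).le (IsUltrametricDist.norm_natCast_le_one K M)
      have htn : ‖t none‖ ≤ ‖π‖ ^ 2 := by
        rw [eq_neg_of_add_eq_zero_left ht0, norm_neg]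
        exact hle
      -- The relative valuation of this term is odd and at least 2. The value 3 would require `m ∣ j
      -- + 1`, but `0 < j + 1 < m`.
      have htn4 : Near (‖π‖ ^ 4) (t none) 0 := by
        rw [Near, sub_zero]
        rcases texp_none with h0 | ⟨k, hk, hk0⟩
        · rw [h0, norm_zero]
          exact (h.pow_pos _).le
        · rw [hk, ← zpow_natCast, h.zpow_le_iff] at htn ⊢
          push_cast at htn ⊢
          by_contra hlt
          have h2 : (m : ℤ) * (-k) = j + 1 := by
            rw [mul_neg]
            omega
          have h3 := Int.eq_zero_of_mul_eq h2 (by omega) (by omega)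
          rw [h3, mul_zero] at h2
          omega
      have := (htn4.add hs).symm
      rw [ht0, zero_add] at this
      exact h.not_near_zero M this

/-- The lower bound for the fields with a uniformizer satisfying `π² ≡ 2` modulo `π⁵`. -/
theorem exists_anisotropic {d m : ℕ} (hd : d = 2 * m) (hm : Odd m) :
    ∃ a : Option (Fin (m - 1) × Fin 3 ⊕ Unit) → K,
      ∀ x : Option (Fin (m - 1) × Fin 3 ⊕ Unit) → K, ∑ i, a i * x i ^ d = 0 → x = 0 := by
  have hm1 : 1 ≤ m := hm.pos
  -- Three terms for each exponent below `m - 1`, one for `m - 1`, and the term with `π`: together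
  -- `3 m - 1` variables.
  refine ⟨_, fun x => h.anisotropic_theta hd hm
    (J := Sum.elim (fun p => (p.1 : ℕ)) fun _ => m - 1) ?_ ?_ ?_ x⟩
  · rintro (p | _)
    · have := p.1.isLt
      simp only [Sum.elim_inl]
      omega
    · simp only [Sum.elim_inr]
      omega
  · intro j
    by_cases hj : j = m - 1
    · refine le_trans (Finset.card_le_one.mpr ?_) (by norm_num)
      rintro (p | _) hp (q | _) hq <;> simp_all
      all_goals omega
    · refine (Finset.card_le_card_of_injOn
        (Sum.elim (fun p : Fin (m - 1) × Fin 3 => p.2) fun _ => 0) (t := Finset.univ)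
        (fun _ _ => by simp) ?_).trans (by simp)
      rintro (p | _) hp (q | _) hq hpq
      · simp only [Finset.coe_filter, Set.mem_ofPred_eq, Finset.mem_univ, true_and,
          Sum.elim_inl] at hp hq hpq
        rw [Prod.ext (Fin.ext (hp.trans hq.symm)) hpq]
      · simp only [Finset.coe_filter, Set.mem_ofPred_eq, Finset.mem_univ, true_and,
          Sum.elim_inr] at hq
        exact absurd hq.symm hj
      · simp only [Finset.coe_filter, Set.mem_ofPred_eq, Finset.mem_univ, true_and,
          Sum.elim_inr] at hp
        exact absurd hp.symm hj
      · rfl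
  · refine Finset.card_le_one.mpr ?_
    rintro (p | _) hp (q | _) hq
    · have := p.1.isLt
      simp only [Finset.mem_filter, Sum.elim_inl] at hp
      omega
    · have := p.1.isLt
      simp only [Finset.mem_filter, Sum.elim_inl] at hp
      omega
    · have := q.1.isLt
      simp only [Finset.mem_filter, Sum.elim_inl] at hq
      omega
    · rfl

end lower

end IsModel

/-! ### The quadratic extensions as models -/

theorem Padic.norm_lt_one_or {a : ℚ_[2]} (ha : ‖a‖ ≤ 1) : ‖a‖ < 1 ∨ ‖a - 1‖ < 1 := by
  obtain ⟨x, rfl⟩ : ∃ x : ℤ_[2], (x : ℚ_[2]) = a := ⟨⟨a, ha⟩, rfl⟩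
  have h := PadicInt.norm_sub_zmodRepr_lt_one x
  have h2 := PadicInt.zmodRepr_lt_p x
  generalize x.zmodRepr = n at h h2
  rw [PadicInt.norm_def, PadicInt.coe_sub, PadicInt.coe_natCast] at h
  interval_cases n
  · left; simpa using h
  · right; simpa using h

theorem norm_ne_zero_of_sq {K : Type*} [NormedField K] {π : K} (hπ : ‖π‖ ^ 2 = 1 / 2) :
    ‖π‖ ≠ 0 := fun h => by norm_num [h] at hπ

theorem norm_lt_one_of_sq {K : Type*} [NormedField K] {π : K} (hπ : ‖π‖ ^ 2 = 1 / 2) :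
    ‖π‖ < 1 := by nlinarith [norm_nonneg π]

section

variable {K : Type*} [NormedField K] [NormedAlgebra ℚ_[2] K]

theorem norm_two_eq_half : ‖(2 : K)‖ = 1 / 2 := by
  have h := norm_algebraMap' K (2 : ℚ_[2])
  rw [map_ofNat] at h
  rw [h]
  simpa using Padic.norm_p (p := 2)

theorem exists_norm_algebraMap {π : K} (hπ : ‖π‖ ^ 2 = 1 / 2) {a : ℚ_[2]}
    (ha : a ≠ 0) :
    ∃ n : ℤ, ‖algebraMap ℚ_[2] K a‖ = ‖π‖ ^ (2 * n) := by
  obtain ⟨n, hn⟩ := Padic.padicNormE.image ha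
  refine ⟨n, ?_⟩
  rw [norm_algebraMap', hn, zpow_mul, zpow_ofNat, hπ]
  simp

/-- Elements of `ℚ_[2]` have even valuation in terms of `π`, their multiples by `π` odd valuation.
Hence the norm of `a + bπ` is always the larger of the two norms. -/
theorem norm_algebraMap_ne {π : K} (hπ : ‖π‖ ^ 2 = 1 / 2) {a : ℚ_[2]} (ha : a ≠ 0)
    (b : ℚ_[2]) :
    ‖algebraMap ℚ_[2] K a‖ ≠ ‖algebraMap ℚ_[2] K b * π‖ := by
  by_cases hb : b = 0
  · simpa [hb] using ha
  obtain ⟨n, hn⟩ := exists_norm_algebraMap hπ ha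
  obtain ⟨k, hk⟩ := exists_norm_algebraMap hπ hb
  rw [norm_mul, hn, hk, ← zpow_add_one₀ (norm_ne_zero_of_sq hπ)]
  intro h
  have := zpow_right_injective₀ (norm_pos_iff.mpr (norm_ne_zero_iff.mp (norm_ne_zero_of_sq hπ)))
    (norm_lt_one_of_sq hπ).ne h
  omega

variable [IsUltrametricDist K]

/-- A root of an Eisenstein polynomial `x ^ 2 - B x - A` is a uniformizer. -/
theorem norm_sq_eq_half {π : K} {A B : ℤ} (hA : A % 4 = 2) (hB : B % 2 = 0)
    (hsq : π ^ 2 = A + B * π) : ‖π‖ ^ 2 = 1 / 2 := by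
  have hnA : ‖(A : K)‖ = 1 / 2 := by
    obtain ⟨k, hk⟩ : ∃ k, A = 2 + 4 * k := ⟨A / 4, by omega⟩
    have : Near (1 / 4) (A : K) 2 := by
      rw [Near, hk]
      push_cast
      rw [add_sub_cancel_left, norm_mul, show (4 : K) = 2 * 2 by norm_num, norm_mul,
        norm_two_eq_half]
      have := IsUltrametricDist.norm_intCast_le_one K k
      linarith
    rw [this.norm_eq (by rw [norm_two_eq_half]; norm_num), norm_two_eq_half]
  have hnB : ‖(B : K) * π‖ ≤ 1 / 2 * ‖π‖ := by
    obtain ⟨k, hk⟩ : ∃ k, B = 2 * k := ⟨B / 2, by omega⟩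
    rw [norm_mul, hk]
    push_cast
    rw [norm_mul, norm_two_eq_half]
    have := IsUltrametricDist.norm_intCast_le_one K k
    have := norm_nonneg π
    gcongr
    linarith
  have hlt : ‖π‖ < 1 := by
    by_contra hge
    have h1 := IsUltrametricDist.norm_add_le_max (A : K) (B * π)
    rw [← hsq, norm_pow, hnA] at h1
    rcases le_max_iff.mp h1 with h | h <;> nlinarith
  have : Near (‖(B : K) * π‖) (π ^ 2) A := by rw [Near, hsq, add_sub_cancel_left]
  rw [← norm_pow, this.norm_eq (by linarith), hnA]

theorem norm_algebraMap_add {π : K} (hπ : ‖π‖ ^ 2 = 1 / 2) (a b : ℚ_[2]) :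
    ‖algebraMap ℚ_[2] K a + algebraMap ℚ_[2] K b * π‖ =
      max ‖algebraMap ℚ_[2] K a‖ ‖algebraMap ℚ_[2] K b * π‖ := by
  by_cases ha : a = 0
  · rw [ha, map_zero, zero_add, norm_zero, max_eq_right (norm_nonneg _)]
  · exact IsUltrametricDist.norm_add_eq_max_of_norm_ne_norm (norm_algebraMap_ne hπ ha b)

end

theorem isModel_of_sq {K : Type*} [NormedField K] [NormedAlgebra ℚ_[2] K] [IsUltrametricDist K]
    {π : K} {A B : ℤ} {P Q : ℕ} (hA : A % 4 = 2) (hB : B % 2 = 0) (hP : (8 : ℤ) ∣ A - P)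
    (hQ : (4 : ℤ) ∣ B - Q) (hsq : π ^ 2 = A + B * π)
    (hspan : ∀ x : K, ∃ a b : ℚ_[2], x = algebraMap ℚ_[2] K a + algebraMap ℚ_[2] K b * π) :
    IsModel π P Q := by
  have hπ := norm_sq_eq_half hA hB hsq
  have h0 := norm_ne_zero_of_sq hπ
  refine ⟨lt_of_le_of_ne (norm_nonneg _) h0.symm, norm_lt_one_of_sq hπ, fun x hx => ?_,
    fun x hx => ?_, by rw [norm_two_eq_half, hπ], ?_⟩
  · obtain ⟨a, b, rfl⟩ := hspan x
    have hb : b ≠ 0 → ∃ n : ℤ, ‖algebraMap ℚ_[2] K b * π‖ = ‖π‖ ^ n := fun hb => by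
      obtain ⟨k, hk⟩ := exists_norm_algebraMap hπ hb
      exact ⟨2 * k + 1, by rw [norm_mul, hk, zpow_add_one₀ h0]⟩
    by_cases ha : a = 0
    · have hb0 : b ≠ 0 := by
        rintro rfl
        simp [ha] at hx
      simpa [ha] using hb hb0
    · obtain ⟨n, hn⟩ := exists_norm_algebraMap hπ ha
      by_cases hb0 : b = 0
      · exact ⟨2 * n, by simpa [hb0] using hn⟩
      · rw [norm_algebraMap_add hπ]
        rcases max_choice ‖algebraMap ℚ_[2] K a‖ ‖algebraMap ℚ_[2] K b * π‖ with h | h <;> rw [h]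
        · exact ⟨_, hn⟩
        · exact hb hb0
  · obtain ⟨a, b, rfl⟩ := hspan x
    rw [norm_algebraMap_add hπ, max_le_iff] at hx
    have hb : ‖algebraMap ℚ_[2] K b * π‖ < 1 := by
      refine lt_of_le_of_ne hx.2 fun h => norm_algebraMap_ne hπ one_ne_zero b ?_
      rw [h, map_one, norm_one]
    rw [norm_algebraMap'] at hx
    rcases Padic.norm_lt_one_or hx.1 with h | h
    · left
      rw [norm_algebraMap_add hπ, norm_algebraMap']
      exact max_lt h hb
    · right
      rw [show algebraMap ℚ_[2] K a + algebraMap ℚ_[2] K b * π - 1 =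
        algebraMap ℚ_[2] K (a - 1) + algebraMap ℚ_[2] K b * π by rw [map_sub, map_one]; ring,
        norm_algebraMap_add hπ, norm_algebraMap']
      exact max_lt h hb
  · obtain ⟨k, hk⟩ := hP
    obtain ⟨l, hl⟩ := hQ
    have h2 : ‖(2 : K)‖ = ‖π‖ ^ 2 := by rw [norm_two_eq_half, hπ]
    have hlt := norm_lt_one_of_sq hπ
    have hk' := IsUltrametricDist.norm_intCast_le_one K k
    have hl' := IsUltrametricDist.norm_intCast_le_one K l
    have e : π ^ 2 - (P + Q * π) = 2 ^ 3 * (k : K) + 2 ^ 2 * π * l := by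
      have hk2 := congrArg (Int.cast : ℤ → K) hk
      have hl2 := congrArg (Int.cast : ℤ → K) hl
      push_cast at hk2 hl2
      linear_combination hsq + hk2 + hl2 * π
    rw [Near, e]
    refine (IsUltrametricDist.norm_add_le_max _ _).trans (max_le ?_ ?_)
    · rw [norm_mul, norm_pow, h2, ← pow_mul]
      exact (mul_le_of_le_one_right (by positivity) hk').trans
        (pow_le_pow_of_le_one (norm_nonneg _) hlt.le (by norm_num))
    · rw [norm_mul, norm_mul, norm_pow, h2, ← pow_mul, ← pow_succ]
      exact mul_le_of_le_one_right (by positivity) hl'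

/-- The uniformizer is `π = r + c`, with `π² = (D - c²) + 2cπ`, and the norm is the spectral norm.
The equality `N.toField = F` transports results back to the given field structure. -/
theorem exists_isModel {K : Type*} [F : Field K] [Algebra ℚ_[2] K] {D : ℤ} (h : IsQ2Sqrt D K)
    (c : ℤ) {P Q : ℕ} (hA : (D - c ^ 2) % 4 = 2)
    (hP : (8 : ℤ) ∣ D - c ^ 2 - P) (hQ : (4 : ℤ) ∣ 2 * c - Q) :
    ∃ N : NormedField K, N.toField = F ∧ IsUltrametricDist K ∧ ProperSpace K ∧
      ∃ π : K, IsModel π P Q := by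
  obtain ⟨r, hr, htop⟩ := h
  have hint : IsIntegral ℚ_[2] r := by
    refine ⟨Polynomial.X ^ 2 - Polynomial.C (D : ℚ_[2]),
      Polynomial.monic_X_pow_sub_C _ two_ne_zero, ?_⟩
    rw [← Polynomial.aeval_def]
    simp [hr]
  have hfin : FiniteDimensional ℚ_[2] K := by
    have := IntermediateField.adjoin.finiteDimensional hint
    rw [htop] at this
    exact Module.Finite.equiv IntermediateField.topEquiv.toLinearEquiv
  have hspan : ∀ x : K, ∃ a b : ℚ_[2], x = algebraMap ℚ_[2] K a + algebraMap ℚ_[2] K b * r := by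
    intro x
    have hx : x ∈ Algebra.adjoin ℚ_[2] {r} := by
      rw [← IntermediateField.adjoin_simple_toSubalgebra_of_isAlgebraic hint.isAlgebraic, htop]
      trivial
    induction hx using Algebra.adjoin_induction with
    | mem y hy => exact ⟨0, 1, by simp [Set.mem_singleton_iff.mp hy]⟩
    | algebraMap a => exact ⟨a, 0, by simp⟩
    | add y z _ _ hy hz =>
      obtain ⟨a, b, rfl⟩ := hy
      obtain ⟨a', b', rfl⟩ := hz
      exact ⟨a + a', b + b', by simp only [map_add]; ring⟩
    | mul y z _ _ hy hz =>
      obtain ⟨a, b, rfl⟩ := hy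
      obtain ⟨a', b', rfl⟩ := hz
      refine ⟨a * a' + b * b' * D, a * b' + b * a', ?_⟩
      simp only [map_add, map_mul, map_intCast]
      linear_combination (algebraMap ℚ_[2] K b * algebraMap ℚ_[2] K b') * hr
  let N := spectralNorm.normedField ℚ_[2] K
  let := spectralNorm.normedAlgebra ℚ_[2] K
  have hu : IsUltrametricDist K :=
    IsUltrametricDist.isUltrametricDist_of_isNonarchimedean_norm isNonarchimedean_spectralNorm
  refine ⟨N, rfl, hu, FiniteDimensional.proper ℚ_[2] K, r + c, ?_⟩
  refine isModel_of_sq (A := D - c ^ 2) (B := 2 * c) hA (by omega) hP hQ ?_ fun x => ?_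
  · push_cast
    linear_combination hr
  · obtain ⟨a, b, rfl⟩ := hspan x
    refine ⟨a - b * c, b, ?_⟩
    simp only [map_sub, map_mul, map_intCast]
    ring

theorem gammaStarEq_three_halves {K : Type*} [NormedField K] [IsUltrametricDist K] [ProperSpace K]
    {π : K} (h : IsModel π 2 0) {d m : ℕ} (hd : d = 2 * m) (hm : Odd m) (hm3 : 3 ≤ m) :
    GammaStarEq d K (3 * d / 2) := by
  obtain ⟨a, ha⟩ := h.exists_anisotropic hd hm
  rw [show 3 * d / 2 = 3 * m by omega]
  refine isLeast_of_not_guaranteesZero (by omega) ?_ (guaranteesZero_three_halves h hd hm hm3) ha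
  simp only [Fintype.card_option, Fintype.card_sum, Fintype.card_prod, Fintype.card_fin,
    Fintype.card_unit]
  omega

theorem gammaStarEq_succ {K : Type*} [NormedField K] [IsUltrametricDist K]
    {π : K} {P Q d : ℕ} (h : IsModel π P Q) (hd : d ≠ 0) (hG : GuaranteesZero d (d + 1) K) :
    GammaStarEq d K (d + 1) :=
  isLeast_of_not_guaranteesZero hd (by simp) hG (h.anisotropic_powers hd)

end AdditiveForm

theorem theorem1 (d m : ℕ) (hd : d = 2 * m) (hm : Odd m) (hm3 : 3 ≤ m)
    (K : Type*) [Field K] [Algebra ℚ_[2] K] :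
    (IsQ2Sqrt 2 K ∨ IsQ2Sqrt 10 K ∨ IsQ2Sqrt (-2) K ∨ IsQ2Sqrt (-10) K →
      GammaStarEq d K (3 * d / 2)) ∧
    (IsQ2Sqrt (-1) K ∨ IsQ2Sqrt (-5) K →
      GammaStarEq d K (d + 1)) := by
  -- An even `c` with `D - c² ≡ 2` modulo 8 is 0 for `D = 2, 10` and 2 for `D = -2, -10`; then `2c ≡
  -- 0` modulo 4.
  have key {D : ℤ} (h : IsQ2Sqrt D K) (c : ℤ) (hA : (D - c ^ 2) % 4 = 2) (hc : c % 2 = 0)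
      (hP : (8 : ℤ) ∣ D - c ^ 2 - 2) : GammaStarEq d K (3 * d / 2) := by
    obtain ⟨N, rfl, hu, hp, π, hπ⟩ := AdditiveForm.exists_isModel (P := 2) (Q := 0) h c hA
      (by simpa using hP) (by push_cast; omega)
    exact AdditiveForm.gammaStarEq_three_halves hπ hd hm hm3
  refine ⟨?_, ?_⟩
  · rintro (h | h | h | h)
    · exact key h 0 (by norm_num) (by norm_num) (by norm_num)
    · exact key h 0 (by norm_num) (by norm_num) (by norm_num)
    · exact key h 2 (by norm_num) (by norm_num) (by norm_num)
    · exact key h 2 (by norm_num) (by norm_num) (by norm_num)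
  · rintro (h | h)
    -- With `c = 1` the relation is `π² = -2 + 2π ≡ 6 + 2π` for `D = -1`, and `π² = -6 + 2π ≡ 2 +
    -- 2π` for `D = -5`.
    · obtain ⟨N, rfl, hu, hp, π, hπ⟩ := AdditiveForm.exists_isModel (P := 6) (Q := 2) h 1
        (by norm_num) (by norm_num) (by norm_num)
      exact AdditiveForm.gammaStarEq_succ hπ (by omega)
        (AdditiveForm.guaranteesZero_succ_of_six_two hπ hd hm hm3)
    · obtain ⟨N, rfl, hu, hp, π, hπ⟩ := AdditiveForm.exists_isModel (P := 2) (Q := 2) h 1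
        (by norm_num) (by norm_num) (by norm_num)
      exact AdditiveForm.gammaStarEq_succ hπ (by omega)
        (AdditiveForm.guaranteesZero_succ_of_two_two hπ hd hm hm3)
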